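/- Let $\alpha\in(0,1)$ and let $\mathbb T\subset\mathbb C$ be the unit circle. For $f:\mathbb T\to\mathbb C$ differentiable along $\mathbb T$, $f'$ denotes the function with $\frac{d}{d\theta}f(e^{i\theta})=ie^{i\theta}f'(e^{i\theta})$. Put $\|g\|_{\alpha}=\|g\|_{L^\infty}+\sup_{w\ne\xi}\frac{|g(w)-g(\xi)|}{|w-\xi|^{\alpha}}$ and $\|h\|_{1+\alpha}=\|h\|_{L^\infty}+\|h'\|_{\alpha}$, the norms of $C^{\alpha}(\mathbb T)$ and $C^{1+\alpha}(\mathbb T)$, and consider the real normed spaces $$X=\Big\{h\in C^{1+\alpha}(\mathbb T;\mathbb C):\ h(w)=\sum_{n\ge2}a_nw^n,\ a_n\in\mathbb R\Big\},\qquad Y=\Big\{g\in C^{\alpha}(\mathbb T;\mathbb R):\ g(w)=\sum_{n\ge1}g_n\,\mathrm{Im}(w^n),\ g_n\in\mathbb R\Big\},$$ where the series converge pointwise on $\mathbb T$. Write $B_r$ for the open ball of $X$ with center $0$ and radius $r$. For $Q\in\mathbb R$, $f\in X$ and $w\in\mathbb T$ let $\Phi_f(w)=w+\frac Qw+f(w)$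 (which depends on $Q$) and $$F(Q,f)(w)=\mathrm{Im}\left\{\left(\frac{1-Q^2}{2}\,\overline{\Phi_f(w)}+\frac1{2\pi i}\int_{\mathbb T}\frac{\overline{\Phi_f(\xi)}-\overline{\Phi_f(w)}}{\Phi_f(\xi)-\Phi_f(w)}\,\Phi_f'(\xi)\,d\xi\right)w\,\Phi_f'(w)\right\}.$$ Let $\varepsilon\in(0,1)$ and $r_\varepsilon=\frac{1-\varepsilon}{2}$. Then $F$ is well defined on $(0,\varepsilon)\times B_{r_\varepsilon}$: for all $(Q,f)$ in this set, $\Phi_f$ is injective on $\mathbb T$ and the integral converges absolutely for every $w\in\mathbb T$. Moreover: 1. $F$ maps $(0,\varepsilon)\times B_{r_\varepsilon}$ into $Y$, and $F:(0,\varepsilon)\times B_{r_\varepsilon}\to Y$ is of class $C^1$. 2. The mixed derivative $\partial_Q\partial_fF(Q,f)$ exists for every $(Q,f)\in(0,\varepsilon)\times B_{r_\varepsilon}$ as the derivative at $Q$ of the map $q\mapsto\partial_fF(q,f)$ with values in the space $\mathcal L(X,Y)$ of bounded linear operators with the operator norm, and $\partial_Q\partial_fF:(0,\varepsilon)\times B_{r_\varepsilon}\to\mathcal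 L(X,Y)$ is continuous. -/

import Mathlib

open Set Filter Topology
open scoped NNReal

noncomputable section

namespace VState

/-! ### Hölder spaces on the unit circle

`Circle` carries the chordal distance `|w - ξ|` induced from `ℂ`. -/

/-- The `E`-valued `α`-Hölder functions on the unit circle, as a subspace of the continuous
functions. -/
def holderSubmodule (α : ℝ≥0) (E : Type*) [NormedAddCommGroup E] [NormedSpace ℝ E] :
    Submodule ℝ C(Circle, E) where
  carrier := {f | MemHolder α (f : Circle → E)}
  add_mem' := fun {f g} hf hg => by
    simpa using MemHolder.add (f := (f : Circle → E)) (g := (g : Circle → E)) hf hg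
  zero_mem' := (memHolder_zero : MemHolder α (0 : Circle → E))
  smul_mem' := fun c f hf => by
    simpa using MemHolder.smul (f := (f : Circle → E)) (c := c) hf

/-- The Hölder space `C^α(𝕋; E)`.  (A type of its own, since its norm is not the norm of uniform
convergence inherited from `C(Circle, E)`.) -/
def HolderSpace (α : ℝ≥0) (E : Type*) [NormedAddCommGroup E] [NormedSpace ℝ E] : Type _ :=
  holderSubmodule α E

namespace HolderSpace

variable {α : ℝ≥0} {E : Type*} [NormedAddCommGroup E] [NormedSpace ℝ E]

instance : AddCommGroup (HolderSpace α E) := inferInstanceAs (AddCommGroup (holderSubmodule α E))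

instance : Module ℝ (HolderSpace α E) := inferInstanceAs (Module ℝ (holderSubmodule α E))

/-- The underlying continuous function. -/
def toCont : HolderSpace α E →ₗ[ℝ] C(Circle, E) := (holderSubmodule α E).subtype

theorem toCont_injective : Function.Injective (toCont : HolderSpace α E → C(Circle, E)) :=
  Subtype.val_injective

theorem memHolder (f : HolderSpace α E) : MemHolder α (toCont f : Circle → E) := f.2

instance : FunLike (HolderSpace α E) Circle E where
  coe f := toCont f
  coe_injective := fun _ _ h => toCont_injective (DFunLike.coe_injective h)

/-- `‖f‖_α = ‖f‖_∞ + [f]_α`. -/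
instance : Norm (HolderSpace α E) :=
  ⟨fun f => ‖toCont f‖ + (nnHolderNorm α (toCont f : Circle → E) : ℝ)⟩

theorem norm_def (f : HolderSpace α E) :
    ‖f‖ = ‖toCont f‖ + (nnHolderNorm α (toCont f : Circle → E) : ℝ) := rfl

theorem normCore : NormedSpace.Core ℝ (HolderSpace α E) where
  norm_nonneg f := by rw [norm_def]; positivity
  norm_smul c f := by
    have h := f.memHolder.nnHolderNorm_smul c
    rw [norm_def, norm_def, map_smul, norm_smul, ContinuousMap.coe_smul, h]
    push_cast
    ring
  norm_triangle f g := by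
    have h : (nnHolderNorm α ((toCont f : Circle → E) + (toCont g : Circle → E)) : ℝ) ≤
        nnHolderNorm α (toCont f : Circle → E) + nnHolderNorm α (toCont g : Circle → E) := by
      exact_mod_cast f.memHolder.nnHolderNorm_add_le g.memHolder
    have h' := norm_add_le (toCont f) (toCont g)
    rw [norm_def, norm_def, norm_def, map_add, ContinuousMap.coe_add]
    linarith
  norm_eq_zero_iff f := by
    rw [norm_def]
    constructor
    · intro h
      have h1 := norm_nonneg (toCont f)
      have h2 := (nnHolderNorm α (toCont f : Circle → E)).coe_nonneg
      have h3 : ‖toCont f‖ = 0 := by linarith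
      exact toCont_injective (by rw [norm_eq_zero.1 h3, map_zero])
    · rintro rfl
      simp

instance : NormedAddCommGroup (HolderSpace α E) := NormedAddCommGroup.ofCore normCore

instance : NormedSpace ℝ (HolderSpace α E) := NormedSpace.ofCore normCore

end HolderSpace

/-! ### Differentiation on the circle and the space `C^{1+α}` -/

/-- `f` is differentiable along the circle at every point. -/
def CircleDifferentiable (f : Circle → ℂ) : Prop :=
  ∀ w : Circle, DifferentiableAt ℝ (fun t : ℝ => f (Circle.exp t * w)) 0

/-- The derivative `f'(w) = df/dw` of a function on the circle: at `w = e^{iθ}` it satisfies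
`d/dθ f(e^{iθ}) = i w f'(w)`. -/
def circleDeriv (f : Circle → ℂ) (w : Circle) : ℂ :=
  deriv (fun t : ℝ => f (Circle.exp t * w)) 0 / (Complex.I * w)

theorem circleDeriv_add {f g : Circle → ℂ} (hf : CircleDifferentiable f)
    (hg : CircleDifferentiable g) : circleDeriv (f + g) = circleDeriv f + circleDeriv g := by
  funext w
  have h := deriv_add (hf w) (hg w)
  simp only [circleDeriv, Pi.add_apply, ← add_div]
  exact congrArg (· / (Complex.I * (w : ℂ))) h

theorem circleDeriv_smul (c : ℝ) {f : Circle → ℂ} (hf : CircleDifferentiable f) :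
    circleDeriv (c • f) = c • circleDeriv f := by
  funext w
  have h := deriv_const_smul c (hf w)
  simp only [circleDeriv, Pi.smul_apply, ← smul_div_assoc]
  exact congrArg (· / (Complex.I * (w : ℂ))) h

theorem circleDeriv_zero : circleDeriv 0 = 0 := by
  funext w
  simp [circleDeriv]

/-- The complex-valued functions of class `C^{1+α}` on the circle. -/
def c1HolderSubmodule (α : ℝ≥0) : Submodule ℝ C(Circle, ℂ) where
  carrier := {f | CircleDifferentiable f ∧ Continuous (circleDeriv f) ∧
    MemHolder α (circleDeriv f)}
  add_mem' := fun {f g} hf hg => by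
    refine ⟨fun w => (hf.1 w).add (hg.1 w), ?_, ?_⟩
    · rw [ContinuousMap.coe_add, circleDeriv_add hf.1 hg.1]
      exact hf.2.1.add hg.2.1
    · rw [ContinuousMap.coe_add, circleDeriv_add hf.1 hg.1]
      exact hf.2.2.add hg.2.2
  zero_mem' := by
    refine ⟨fun w => differentiableAt_const _, ?_, ?_⟩
    · rw [ContinuousMap.coe_zero, circleDeriv_zero]
      exact continuous_zero
    · rw [ContinuousMap.coe_zero, circleDeriv_zero]
      exact memHolder_zero
  smul_mem' := fun c f hf => by
    refine ⟨fun w => (hf.1 w).const_smul c, ?_, ?_⟩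
    · rw [ContinuousMap.coe_smul, circleDeriv_smul c hf.1]
      exact hf.2.1.const_smul c
    · rw [ContinuousMap.coe_smul, circleDeriv_smul c hf.1]
      exact hf.2.2.smul

/-- The space `C^{1+α}(𝕋)` of complex-valued functions. -/
def C1Holder (α : ℝ≥0) : Type := c1HolderSubmodule α

namespace C1Holder

variable {α : ℝ≥0}

instance : AddCommGroup (C1Holder α) := inferInstanceAs (AddCommGroup (c1HolderSubmodule α))

instance : Module ℝ (C1Holder α) := inferInstanceAs (Module ℝ (c1HolderSubmodule α))

/-- The underlying continuous function. -/
def toCont : C1Holder α →ₗ[ℝ] C(Circle, ℂ) := (c1HolderSubmodule α).subtype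

theorem toCont_injective : Function.Injective (toCont : C1Holder α → C(Circle, ℂ)) :=
  Subtype.val_injective

theorem circleDifferentiable (f : C1Holder α) : CircleDifferentiable (toCont f) := f.2.1

instance : FunLike (C1Holder α) Circle ℂ where
  coe f := toCont f
  coe_injective := fun _ _ h => toCont_injective (DFunLike.coe_injective h)

/-- The derivative `f ↦ f'` from `C^{1+α}(𝕋)` to `C^α(𝕋)`. -/
def derivL : C1Holder α →ₗ[ℝ] HolderSpace α ℂ where
  toFun f := ⟨⟨circleDeriv (toCont f), f.2.2.1⟩, f.2.2.2⟩
  map_add' f g := HolderSpace.toCont_injective (DFunLike.coe_injective (by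
    exact circleDeriv_add f.circleDifferentiable g.circleDifferentiable))
  map_smul' c f := HolderSpace.toCont_injective (DFunLike.coe_injective (by
    exact circleDeriv_smul c f.circleDifferentiable))

/-- `‖f‖_{1+α} = ‖f‖_∞ + ‖f'‖_∞ + [f']_α`. -/
instance : Norm (C1Holder α) := ⟨fun f => ‖toCont f‖ + ‖derivL f‖⟩

theorem norm_def (f : C1Holder α) : ‖f‖ = ‖toCont f‖ + ‖derivL f‖ := rfl

theorem normCore : NormedSpace.Core ℝ (C1Holder α) where
  norm_nonneg f := by rw [norm_def]; positivity
  norm_smul c f := by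
    rw [norm_def, norm_def, map_smul, map_smul, norm_smul, norm_smul]
    ring
  norm_triangle f g := by
    have h := norm_add_le (toCont f) (toCont g)
    have h' := norm_add_le (derivL f) (derivL g)
    rw [norm_def, norm_def, norm_def, map_add, map_add]
    linarith
  norm_eq_zero_iff f := by
    rw [norm_def]
    constructor
    · intro h
      have h1 := norm_nonneg (toCont f)
      have h2 := norm_nonneg (derivL f)
      have h3 : ‖toCont f‖ = 0 := by linarith
      exact toCont_injective (by rw [norm_eq_zero.1 h3, map_zero])
    · rintro rfl
      simp

instance : NormedAddCommGroup (C1Holder α) := NormedAddCommGroup.ofCore normCore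

instance : NormedSpace ℝ (C1Holder α) := NormedSpace.ofCore normCore

end C1Holder

/-! ### The spaces `X` and `Y` -/

/-- `X = {h ∈ C^{1+α}(𝕋) : h(w) = ∑_{n ≥ 2} a_n w^n, a_n ∈ ℝ}`, with the norm of `C^{1+α}`. -/
def X (α : ℝ≥0) : Submodule ℝ (C1Holder α) where
  carrier := {h | ∃ a : ℕ → ℝ, ∀ w : Circle,
    Tendsto (fun N : ℕ => ∑ n ∈ Finset.Icc 2 N, (a n : ℂ) * (w : ℂ) ^ n) atTop (𝓝 (h w))}
  add_mem' := by
    rintro f g ⟨a, ha⟩ ⟨b, hb⟩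
    refine ⟨a + b, fun w => ((ha w).add (hb w)).congr fun N => ?_⟩
    rw [← Finset.sum_add_distrib]
    refine Finset.sum_congr rfl fun n _ => ?_
    simp [add_mul]
  zero_mem' := by
    refine ⟨0, fun w => ?_⟩
    exact (tendsto_const_nhds : Tendsto (fun _ : ℕ => (0 : ℂ)) atTop (𝓝 0)).congr (by simp)
  smul_mem' := by
    rintro c f ⟨a, ha⟩
    refine ⟨c • a, fun w => ((ha w).const_smul c).congr fun N => ?_⟩
    rw [Finset.smul_sum]
    refine Finset.sum_congr rfl fun n _ => ?_
    simp [mul_assoc]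

/-- `Y = {g ∈ C^α(𝕋) : g(w) = ∑_{n ≥ 1} g_n e_n(w), g_n ∈ ℝ}` with `e_n(w) = Im (w^n)`, with the
norm of `C^α`. -/
def Y (α : ℝ≥0) : Submodule ℝ (HolderSpace α ℝ) where
  carrier := {g | ∃ c : ℕ → ℝ, ∀ w : Circle,
    Tendsto (fun N : ℕ => ∑ n ∈ Finset.Icc 1 N, c n * ((w : ℂ) ^ n).im) atTop (𝓝 (g w))}
  add_mem' := by
    rintro f g ⟨a, ha⟩ ⟨b, hb⟩
    refine ⟨a + b, fun w => ((ha w).add (hb w)).congr fun N => ?_⟩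
    rw [← Finset.sum_add_distrib]
    refine Finset.sum_congr rfl fun n _ => ?_
    simp [add_mul]
  zero_mem' := by
    refine ⟨0, fun w => ?_⟩
    exact (tendsto_const_nhds : Tendsto (fun _ : ℕ => (0 : ℝ)) atTop (𝓝 0)).congr (by simp)
  smul_mem' := by
    rintro c f ⟨a, ha⟩
    refine ⟨c • a, fun w => ((ha w).const_smul c).congr fun N => ?_⟩
    rw [Finset.smul_sum]
    refine Finset.sum_congr rfl fun n _ => ?_
    simp [mul_assoc]

/-! ### The functional -/

/-- The mean value `⨍_𝕋 f(τ) dτ = (1 / 2πi) ∫_𝕋 f(τ) dτ`, with `τ = e^{iθ}`, `dτ = i e^{iθ} dθ`. -/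
def circleMean (f : Circle → ℂ) : ℂ :=
  (2 * Real.pi * Complex.I)⁻¹ *
    ∫ θ in (0 : ℝ)..(2 * Real.pi), f (Circle.exp θ) * (Complex.I * (Circle.exp θ : ℂ))

/-- The integrand `ξ ↦ (conj Φ(ξ) - conj Φ(w)) / (Φ(ξ) - Φ(w)) * Φ'(ξ)`. -/
def cauchyIntegrand (Φ : Circle → ℂ) (w ξ : Circle) : ℂ :=
  (starRingEnd ℂ (Φ ξ) - starRingEnd ℂ (Φ w)) / (Φ ξ - Φ w) * circleDeriv Φ ξ

/-- `G(Ω, Φ)(w) = (2 Ω conj Φ(w) + ⨍ (conj Φ(ξ) - conj Φ(w)) / (Φ(ξ) - Φ(w)) Φ'(ξ) dξ) w Φ'(w)`. -/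
def G (Ω : ℝ) (Φ : Circle → ℂ) (w : Circle) : ℂ :=
  (2 * Ω * starRingEnd ℂ (Φ w) + circleMean (cauchyIntegrand Φ w)) * w * circleDeriv Φ w

/-- `Φ_f = α_Q + f` with `α_Q(w) = w + Q / w`. -/
def Phi (Q : ℝ) (f : Circle → ℂ) (w : Circle) : ℂ :=
  (w : ℂ) + Q / (w : ℂ) + f w

/-- `F(Q, f) = Im G((1 - Q²) / 4, α_Q + f)`, as a function on the circle. -/
def F (Q : ℝ) (f : Circle → ℂ) (w : Circle) : ℝ :=
  (G ((1 - Q ^ 2) / 4) (Phi Q f) w).im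

/-- The set `(0, ε) × B_{r_ε}` in `ℝ × X`, with `r_ε = (1 - ε) / 2`. -/
def domain (α : ℝ≥0) (ε : ℝ) : Set (ℝ × X α) :=
  Ioo 0 ε ×ˢ Metric.ball 0 ((1 - ε) / 2)

end VState

end

/-!
The functional is nonsingular, and in fact smooth, once the Cauchy integral is written in the
variables `w` and `ζ = ξ / w`.  Let `D Φ (ζ, w) = (Φ(ζ w) - Φ(w)) / (ζ w - w)`, with value `Φ'(w)`
at `ζ = 1`.  Since `conj (ξ - w) / (ξ - w) = -1 / (ξ w)` on the circle,
`G(Ω, Φ)(w) = 2 Ω w conj Φ(w) Φ'(w) - (1 / 2π) Φ'(w) ∫ (conj D Φ / D Φ)(e^{iθ}, w) Φ'(e^{iθ} w) dθ`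
(`circleMean_cauchyIntegrand`).  For fixed `ζ` the mean value inequality, applied to
`Φ(ζ w) / w - Φ(ζ ξ) / ξ` along the arc from `1` to `ζ`, shows that `D Φ (ζ, ·)` lies in `C^α` with
norm at most a constant times the norm of `Φ'`, uniformly in `ζ` (`norm_diffQuot_sub_le`).  Hence
`D` is a bounded linear map into the normed algebra `Kernel α` of bounded families of `C^α`
functions indexed by `ζ`, and integration in `ζ` is a bounded linear map from it back to `C^α`.
Inversion in a normed algebra with convergent geometric series is smooth, so `G` is smooth wherever
`D Φ` is bounded away from `0` (`contDiffAt_smoothG`).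

On the domain, `|D Φ_f| ≥ 1 - Q - (π / 2) ‖f‖ ≥ (1 - ε) (1 - π / 4) > 0`, where `π / 2` is the
largest ratio of an arc, at most a half circle, to its chord (`le_norm_diffQuot_phiC1`); this also gives injectivity.

The values lie in `Y` because the coefficients of `Φ_f` are real: `G` commutes with complex
conjugation, so `F` is odd under `w ↦ w⁻¹`, and an odd Hölder function is the pointwise sum of its
sine series by Dini's test, a consequence of the Riemann-Lebesgue lemma (`mem_Y_of_odd`).  The map
into `Y` is the smooth map `G` followed by the bounded projection `oddImCLM`, which takes the odd
part of the imaginary part and changes nothing on the domain.  The claims about the mixed derivative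
hold for every `C²` map (`mixed_partial_of_contDiffOn`).
-/

noncomputable section

namespace VState

open scoped ENNReal

/-! ### The Hölder space as a normed algebra -/

namespace HolderSpace

theorem holderWith_of_norm_sub_le {α : ℝ≥0} {E : Type*} [NormedAddCommGroup E] {f : Circle → E}
    {C : ℝ} (hC : 0 ≤ C) (h : ∀ w ξ, ‖f w - f ξ‖ ≤ C * dist w ξ ^ (α : ℝ)) :
    HolderWith C.toNNReal α f := by
  intro w ξ
  have h1 : nndist (f w) (f ξ) ≤ C.toNNReal * nndist w ξ ^ (α : ℝ) := by
    rw [← NNReal.coe_le_coe]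
    push_cast
    rw [Real.coe_toNNReal _ hC, dist_eq_norm]
    exact h w ξ
  rw [edist_nndist, edist_nndist, ← ENNReal.coe_rpow_of_nonneg _ α.coe_nonneg]
  exact_mod_cast h1

section Basic

variable {α : ℝ≥0} {E : Type*} [NormedAddCommGroup E] [NormedSpace ℝ E]

@[ext]
theorem ext {f g : HolderSpace α E} (h : ∀ w, f w = g w) : f = g := DFunLike.ext f g h

@[simp]
theorem add_apply (f g : HolderSpace α E) (w : Circle) : (f + g) w = f w + g w := rfl

@[simp]
theorem sub_apply (f g : HolderSpace α E) (w : Circle) : (f - g) w = f w - g w := rfl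

@[simp]
theorem smul_apply (c : ℝ) (f : HolderSpace α E) (w : Circle) : (c • f) w = c • f w := rfl

protected theorem continuous (f : HolderSpace α E) : Continuous f := (toCont f).continuous

theorem norm_apply_le (f : HolderSpace α E) (w : Circle) : ‖f w‖ ≤ ‖f‖ :=
  ((toCont f).norm_coe_le_norm w).trans <| by
    rw [norm_def]; exact le_add_of_nonneg_right (NNReal.coe_nonneg _)

/-- The Hölder estimate in real-valued form, with the seminorm as the constant. -/
theorem norm_sub_le_seminorm (f : HolderSpace α E) (w ξ : Circle) :
    ‖f w - f ξ‖ ≤ nnHolderNorm α (toCont f : Circle → E) * dist w ξ ^ (α : ℝ) := by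
  have h := f.memHolder.holderWith.nndist_le w ξ
  rw [← dist_eq_norm]
  exact_mod_cast h

theorem norm_sub_le (f : HolderSpace α E) (w ξ : Circle) :
    ‖f w - f ξ‖ ≤ ‖f‖ * dist w ξ ^ (α : ℝ) :=
  (f.norm_sub_le_seminorm w ξ).trans <| by
    gcongr
    rw [norm_def]; exact le_add_of_nonneg_left (norm_nonneg _)

theorem norm_le_of_bounds {f : HolderSpace α E} {a b : ℝ} (ha : 0 ≤ a) (hb : 0 ≤ b)
    (h0 : ∀ w, ‖f w‖ ≤ a) (h1 : ∀ w ξ, ‖f w - f ξ‖ ≤ b * dist w ξ ^ (α : ℝ)) : ‖f‖ ≤ a + b := by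
  rw [norm_def]
  refine add_le_add ((ContinuousMap.norm_le _ ha).2 h0) ?_
  have h2 := (holderWith_of_norm_sub_le hb h1).nnholderNorm_le
  have h3 : ((nnHolderNorm α (toCont f : Circle → E) : ℝ≥0) : ℝ) ≤ (b.toNNReal : ℝ≥0) := by
    exact_mod_cast h2
  rwa [Real.coe_toNNReal _ hb] at h3

/-- A function satisfying a Hölder estimate with a positive exponent, as an element of the Hölder
space. -/
def ofBound (hα : 0 < α) (f : Circle → E)
    (h : ∃ C : ℝ, 0 ≤ C ∧ ∀ w ξ, ‖f w - f ξ‖ ≤ C * dist w ξ ^ (α : ℝ)) : HolderSpace α E :=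
  have H : ∃ C, HolderWith C α f := by
    obtain ⟨C, hC, h⟩ := h
    exact ⟨_, holderWith_of_norm_sub_le hC h⟩
  ⟨⟨f, H.choose_spec.continuous hα⟩, H⟩

@[simp]
theorem ofBound_apply (hα : 0 < α) (f : Circle → E)
    (h : ∃ C : ℝ, 0 ≤ C ∧ ∀ w ξ, ‖f w - f ξ‖ ≤ C * dist w ξ ^ (α : ℝ)) (w : Circle) :
    ofBound hα f h w = f w := rfl

/-- Bounded linear maps into the Hölder space, given by a pointwise linear formula together with a
uniform bound and a Hölder bound. -/
def mkCLM {V : Type*} [NormedAddCommGroup V] [NormedSpace ℝ V] (hα : 0 < α)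
    (L : V → Circle → E) (C : ℝ) (hC : 0 ≤ C)
    (hadd : ∀ u v w, L (u + v) w = L u w + L v w) (hsmul : ∀ (c : ℝ) v w, L (c • v) w = c • L v w)
    (h0 : ∀ v w, ‖L v w‖ ≤ C * ‖v‖)
    (h1 : ∀ v w ξ, ‖L v w - L v ξ‖ ≤ C * ‖v‖ * dist w ξ ^ (α : ℝ)) : V →L[ℝ] HolderSpace α E :=
  LinearMap.mkContinuous
    { toFun := fun v => ofBound hα (L v) ⟨C * ‖v‖, by positivity, h1 v⟩
      map_add' := fun u v => ext (hadd u v)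
      map_smul' := fun c v => ext (hsmul c v) }
    (C + C) fun v => by
      have hCv : 0 ≤ C * ‖v‖ := by positivity
      rw [add_mul]
      exact norm_le_of_bounds hCv hCv (h0 v) (h1 v)

@[simp]
theorem mkCLM_apply {V : Type*} [NormedAddCommGroup V] [NormedSpace ℝ V] (hα : 0 < α)
    (L : V → Circle → E) (C : ℝ) (hC : 0 ≤ C)
    (hadd : ∀ u v w, L (u + v) w = L u w + L v w) (hsmul : ∀ (c : ℝ) v w, L (c • v) w = c • L v w)
    (h0 : ∀ v w, ‖L v w‖ ≤ C * ‖v‖)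
    (h1 : ∀ v w ξ, ‖L v w - L v ξ‖ ≤ C * ‖v‖ * dist w ξ ^ (α : ℝ)) (v : V) (w : Circle) :
    mkCLM hα L C hC hadd hsmul h0 h1 v w = L v w := rfl

end Basic

section Algebra

variable {α : ℝ≥0}

theorem norm_mul_sub_mul_le (f g : HolderSpace α ℂ) (w ξ : Circle) :
    ‖f w * g w - f ξ * g ξ‖ ≤
      (‖toCont f‖ * nnHolderNorm α (toCont g : Circle → ℂ) +
        nnHolderNorm α (toCont f : Circle → ℂ) * ‖toCont g‖) * dist w ξ ^ (α : ℝ) := by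
  have h : f w * g w - f ξ * g ξ = f w * (g w - g ξ) + (f w - f ξ) * g ξ := by ring
  rw [h, add_mul]
  refine (norm_add_le _ _).trans (add_le_add ?_ ?_)
  · rw [norm_mul, mul_assoc]
    gcongr
    · exact (toCont f).norm_coe_le_norm w
    · exact g.norm_sub_le_seminorm w ξ
  · rw [norm_mul, mul_right_comm]
    gcongr
    · exact f.norm_sub_le_seminorm w ξ
    · exact (toCont g).norm_coe_le_norm ξ

instance : One (HolderSpace α ℂ) := ⟨⟨1, memHolder_const' (c := (1 : ℂ))⟩⟩

instance : Mul (HolderSpace α ℂ) :=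
  ⟨fun f g => ⟨toCont f * toCont g,
    (holderWith_of_norm_sub_le (by positivity) (norm_mul_sub_mul_le f g)).memHolder⟩⟩

@[simp]
theorem one_apply (w : Circle) : (1 : HolderSpace α ℂ) w = 1 := rfl

@[simp]
theorem mul_apply (f g : HolderSpace α ℂ) (w : Circle) : (f * g) w = f w * g w := rfl

theorem norm_mul_le (f g : HolderSpace α ℂ) : ‖f * g‖ ≤ ‖f‖ * ‖g‖ := by
  have h : ‖f * g‖ ≤ ‖toCont f‖ * ‖toCont g‖ +
      (‖toCont f‖ * nnHolderNorm α (toCont g : Circle → ℂ) +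
        nnHolderNorm α (toCont f : Circle → ℂ) * ‖toCont g‖) := by
    refine norm_le_of_bounds (by positivity) (by positivity) (fun w => ?_)
      (norm_mul_sub_mul_le f g)
    rw [mul_apply, norm_mul]
    gcongr
    · exact (toCont f).norm_coe_le_norm w
    · exact (toCont g).norm_coe_le_norm w
  refine h.trans ?_
  rw [norm_def, norm_def]
  have h1 := (nnHolderNorm α (toCont f : Circle → ℂ)).coe_nonneg
  have h2 := (nnHolderNorm α (toCont g : Circle → ℂ)).coe_nonneg
  nlinarith [mul_nonneg h1 h2]

instance : CommRing (HolderSpace α ℂ) where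
  __ := (NormedAddCommGroup.toAddCommGroup : AddCommGroup (HolderSpace α ℂ))
  mul_assoc f g h := ext fun w => mul_assoc _ _ _
  one_mul f := ext fun w => one_mul _
  mul_one f := ext fun w => mul_one _
  left_distrib f g h := ext fun w => mul_add _ _ _
  right_distrib f g h := ext fun w => add_mul _ _ _
  zero_mul f := ext fun w => zero_mul _
  mul_zero f := ext fun w => mul_zero _
  mul_comm f g := ext fun w => mul_comm _ _

instance : NormedCommRing (HolderSpace α ℂ) where
  __ := (inferInstance : CommRing (HolderSpace α ℂ))
  __ := (inferInstance : NormedAddCommGroup (HolderSpace α ℂ))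
  norm_mul_le := norm_mul_le

instance : Algebra ℝ (HolderSpace α ℂ) :=
  Algebra.ofModule (fun c f g => ext fun w => smul_mul_assoc c (f w) (g w))
    (fun c f g => ext fun w => mul_smul_comm c (f w) (g w))

instance : NormedAlgebra ℝ (HolderSpace α ℂ) where
  norm_smul_le c f := (norm_smul c f).le

instance : NormOneClass (HolderSpace α ℂ) where
  norm_one := by
    refine le_antisymm ?_ ?_
    · have h : ‖(1 : HolderSpace α ℂ)‖ ≤ 1 + 0 :=
        norm_le_of_bounds zero_le_one le_rfl (fun w => by simp) (fun w ξ => by simp)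
      simpa using h
    · simpa using norm_apply_le (1 : HolderSpace α ℂ) 1

theorem norm_inv_sub_inv_le {f : HolderSpace α ℂ} {m : ℝ} (hm : 0 < m) (hf : ∀ w, m ≤ ‖f w‖)
    (w ξ : Circle) : ‖(f w)⁻¹ - (f ξ)⁻¹‖ ≤ ‖f‖ / m ^ 2 * dist w ξ ^ (α : ℝ) := by
  have hne : ∀ w, f w ≠ 0 := fun w => norm_pos_iff.1 (hm.trans_le (hf w))
  rw [inv_sub_inv (hne w) (hne ξ), norm_div, norm_mul, div_mul_eq_mul_div, norm_sub_rev, sq]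
  have h := f.norm_sub_le w ξ
  have h' : 0 ≤ ‖f‖ * dist w ξ ^ (α : ℝ) := (norm_nonneg _).trans h
  gcongr
  · exact hf w
  · exact hf ξ

/-- The pointwise inverse of a Hölder function bounded away from `0`. -/
def invOfBound (f : HolderSpace α ℂ) {m : ℝ} (hm : 0 < m) (hf : ∀ w, m ≤ ‖f w‖) :
    HolderSpace α ℂ :=
  ⟨⟨fun w => (f w)⁻¹, f.continuous.inv₀ fun w => norm_pos_iff.1 (hm.trans_le (hf w))⟩,
    (holderWith_of_norm_sub_le (div_nonneg (norm_nonneg f) (sq_nonneg m))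
      (norm_inv_sub_inv_le hm hf)).memHolder⟩

@[simp]
theorem invOfBound_apply (f : HolderSpace α ℂ) {m : ℝ} (hm : 0 < m) (hf : ∀ w, m ≤ ‖f w‖)
    (w : Circle) : f.invOfBound hm hf w = (f w)⁻¹ := rfl

theorem norm_invOfBound_le (f : HolderSpace α ℂ) {m : ℝ} (hm : 0 < m) (hf : ∀ w, m ≤ ‖f w‖) :
    ‖f.invOfBound hm hf‖ ≤ m⁻¹ + ‖f‖ / m ^ 2 := by
  refine norm_le_of_bounds (by positivity) (div_nonneg (norm_nonneg f) (sq_nonneg m)) (fun w => ?_)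
    (norm_inv_sub_inv_le hm hf)
  rw [invOfBound_apply, norm_inv]
  gcongr
  exact hf w

end Algebra

end HolderSpace

/-! ### Kernels parametrized by the quotient of the two variables -/

section Kernels

variable {α : ℝ≥0}

/-- The algebra of kernels `k(ζ, w)` on `𝕋 × 𝕋` which are bounded and `α`-Hölder in `w`, uniformly
in `ζ`, and measurable in the angle of `ζ`.  A kernel in the variables `w, ξ` is encoded through `ζ = ξ / w`; in
these variables the difference quotient of a `C^{1+α}` function is `α`-Hölder up to the
diagonal `ζ = 1`. -/
def kernelSubalgebra (α : ℝ≥0) : Subalgebra ℝ (lp (fun _ : Circle => HolderSpace α ℂ) ∞) where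
  carrier := {k | ∀ w, Measurable fun θ : ℝ => k (Circle.exp θ) w}
  mul_mem' hk hl w := (hk w).mul (hl w)
  add_mem' hk hl w := (hk w).add (hl w)
  algebraMap_mem' c w := by
    have h : ∀ θ : ℝ, (algebraMap ℝ (lp (fun _ : Circle => HolderSpace α ℂ) ∞) c)
        (Circle.exp θ) w = c • (1 : ℂ) := by
      intro θ
      rw [Algebra.algebraMap_eq_smul_one]
      rfl
    simp only [h]
    exact measurable_const

/-- The normed algebra of kernels `k(ζ, w)`, as a type of its own. -/
def Kernel (α : ℝ≥0) : Type := kernelSubalgebra α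

namespace Kernel

instance : NormedCommRing (Kernel α) := inferInstanceAs (NormedCommRing (kernelSubalgebra α))

instance : NormedAlgebra ℝ (Kernel α) := inferInstanceAs (NormedAlgebra ℝ (kernelSubalgebra α))

instance : NormOneClass (Kernel α) :=
  ⟨(norm_one : ‖(1 : lp (fun _ : Circle => HolderSpace α ℂ) ∞)‖ = 1)⟩

instance : CoeFun (Kernel α) (fun _ => Circle → HolderSpace α ℂ) := ⟨fun k => k.1.1⟩

@[ext]
theorem ext {k l : Kernel α} (h : ∀ ζ w, k ζ w = l ζ w) : k = l :=
  Subtype.ext (lp.ext (funext fun ζ => HolderSpace.ext (h ζ)))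

theorem measurable (k : Kernel α) (w : Circle) :
    Measurable fun θ : ℝ => k (Circle.exp θ) w := k.2 w

theorem norm_apply_le (k : Kernel α) (ζ : Circle) : ‖k ζ‖ ≤ ‖k‖ :=
  lp.norm_apply_le_norm (p := ∞) ENNReal.top_ne_zero k.1 ζ

theorem norm_apply_apply_le (k : Kernel α) (ζ w : Circle) : ‖k ζ w‖ ≤ ‖k‖ :=
  ((k ζ).norm_apply_le w).trans (k.norm_apply_le ζ)

theorem add_apply (k l : Kernel α) (ζ w : Circle) : (k + l) ζ w = k ζ w + l ζ w := rfl

theorem sub_apply (k l : Kernel α) (ζ w : Circle) : (k - l) ζ w = k ζ w - l ζ w := rfl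

theorem mul_apply (k l : Kernel α) (ζ w : Circle) : (k * l) ζ w = k ζ w * l ζ w := rfl

theorem one_apply (ζ w : Circle) : (1 : Kernel α) ζ w = 1 := rfl

theorem smul_apply (c : ℝ) (k : Kernel α) (ζ w : Circle) :
    (c • k) ζ w = c • k ζ w := rfl

/-- Bounded linear maps into the kernel algebra, given by a pointwise linear formula together with
bounds uniform in `ζ`. -/
def mkCLM {V : Type*} [NormedAddCommGroup V] [NormedSpace ℝ V] (hα : 0 < α)
    (L : V → Circle → Circle → ℂ) (C : ℝ) (hC : 0 ≤ C)
    (hadd : ∀ u v ζ w, L (u + v) ζ w = L u ζ w + L v ζ w)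
    (hsmul : ∀ (c : ℝ) v ζ w, L (c • v) ζ w = c • L v ζ w)
    (h0 : ∀ v ζ w, ‖L v ζ w‖ ≤ C * ‖v‖)
    (h1 : ∀ v ζ w ξ, ‖L v ζ w - L v ζ ξ‖ ≤ C * ‖v‖ * dist w ξ ^ (α : ℝ))
    (hm : ∀ v w, Measurable fun θ : ℝ => L v (Circle.exp θ) w) : V →L[ℝ] Kernel α :=
  have hn : ∀ v ζ, ‖HolderSpace.ofBound hα (L v ζ) ⟨C * ‖v‖, by positivity, h1 v ζ⟩‖ ≤
      (C + C) * ‖v‖ := fun v ζ => by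
    have hCv : 0 ≤ C * ‖v‖ := by positivity
    rw [add_mul]
    exact HolderSpace.norm_le_of_bounds hCv hCv (h0 v ζ) (h1 v ζ)
  LinearMap.mkContinuous
    { toFun := fun v => ⟨⟨fun ζ => HolderSpace.ofBound hα (L v ζ) ⟨C * ‖v‖, by positivity, h1 v ζ⟩,
        memℓp_infty ⟨(C + C) * ‖v‖, by rintro _ ⟨ζ, rfl⟩; exact hn v ζ⟩⟩, hm v⟩
      map_add' := fun u v => ext (hadd u v)
      map_smul' := fun c v => ext (hsmul c v) }
    (C + C) fun v => lp.norm_le_of_forall_le (by positivity) (hn v)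

/-- A kernel bounded away from `0` is invertible. -/
theorem isUnit_of_le_norm {k : Kernel α} {m : ℝ} (hm : 0 < m)
    (hk : ∀ ζ w, m ≤ ‖k ζ w‖) : IsUnit k := by
  have hne : ∀ ζ w, k ζ w ≠ 0 := fun ζ w => norm_pos_iff.1 (hm.trans_le (hk ζ w))
  let l : Kernel α :=
    ⟨⟨fun ζ => (k ζ).invOfBound hm (hk ζ), memℓp_infty ⟨m⁻¹ + ‖k‖ / m ^ 2, by
      rintro _ ⟨ζ, rfl⟩
      refine ((k ζ).norm_invOfBound_le hm (hk ζ)).trans ?_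
      gcongr
      exact k.norm_apply_le ζ⟩⟩, fun w => (k.measurable w).inv⟩
  exact IsUnit.of_mul_eq_one l (ext fun ζ w => mul_inv_cancel₀ (hne ζ w))

theorem inverse_apply {k : Kernel α} (hk : IsUnit k) (ζ w : Circle) :
    (Ring.inverse k) ζ w = (k ζ w)⁻¹ := by
  have h : (k * Ring.inverse k) ζ w = 1 := by
    rw [Ring.mul_inverse_cancel k hk, one_apply]
  rw [mul_apply] at h
  exact eq_inv_of_mul_eq_one_right h

/-- Geometric series converge since `1 - k` is invertible for `‖k‖ < 1`: the partial sums differ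
from its inverse by `k ^ n * (1 - k)⁻¹`.  Thus no completeness is needed. -/
instance : HasSummableGeomSeries (Kernel α) where
  summable_geometric_of_norm_lt_one k hk := by
    have hu : IsUnit (1 - k) := by
      refine isUnit_of_le_norm (sub_pos.2 hk) fun ζ w => ?_
      have h := norm_sub_norm_le (1 : ℂ) (k ζ w)
      rw [norm_one] at h
      rw [sub_apply, one_apply]
      exact (sub_le_sub_left (k.norm_apply_apply_le ζ w) _).trans h
    obtain ⟨u, hu⟩ := hu
    have hs : Summable fun n : ℕ => ‖k ^ n‖ :=
      Summable.of_nonneg_of_le (fun n => norm_nonneg _)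
        (fun n => norm_pow_le k n) (summable_geometric_of_lt_one (norm_nonneg _) hk)
    refine (hasSum_of_subseq_of_summable hs tendsto_finset_range
      (a := ((u⁻¹ : (Kernel α)ˣ) : Kernel α)) ?_).summable
    have h1 : ∀ n : ℕ, ∑ i ∈ Finset.range n, k ^ i = ↑u⁻¹ - ↑u⁻¹ * k ^ n := by
      intro n
      have h2 := mul_neg_geom_sum k n
      rw [← hu] at h2
      rw [← mul_one_sub, ← h2, ← mul_assoc, Units.inv_mul, one_mul]
    simp only [h1]
    have h3 := (tendsto_pow_atTop_nhds_zero_of_norm_lt_one hk).const_mul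
      ((u⁻¹ : (Kernel α)ˣ) : Kernel α)
    simpa using h3.const_sub ((u⁻¹ : (Kernel α)ˣ) : Kernel α)

end Kernel

end Kernels

/-! ### Difference quotients on the circle -/

theorem continuous_circle_coe : Continuous fun w : Circle => (w : ℂ) := continuous_subtype_val

theorem dist_circle_eq (w ξ : Circle) : dist w ξ = ‖(w : ℂ) - ξ‖ := by
  rw [← dist_eq_norm]; rfl

theorem dist_circle_mul_left (ζ w ξ : Circle) : dist (ζ * w) (ζ * ξ) = dist w ξ := by
  rw [dist_circle_eq, dist_circle_eq, Circle.coe_mul, Circle.coe_mul, ← mul_sub, norm_mul,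
    Circle.norm_coe, one_mul]

theorem dist_circle_inv_inv (w ξ : Circle) : dist w⁻¹ ξ⁻¹ = dist w ξ := by
  rw [dist_circle_eq, dist_circle_eq, Circle.coe_inv, Circle.coe_inv,
    inv_sub_inv (Circle.coe_ne_zero w) (Circle.coe_ne_zero ξ), norm_div, norm_mul,
    Circle.norm_coe, Circle.norm_coe, norm_sub_rev]
  simp

/-- On the circle, whose diameter is `2`, the chordal distance is dominated by its powers of
exponent at most one. -/
theorem dist_circle_le_rpow {α : ℝ≥0} (hα1 : α < 1) (w ξ : Circle) :
    dist w ξ ≤ 2 * dist w ξ ^ (α : ℝ) := by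
  have hd : (0 : ℝ) ≤ dist w ξ := dist_nonneg
  have hα : (α : ℝ) < 1 := by exact_mod_cast hα1
  have h2 : dist w ξ ≤ 2 := by
    rw [dist_circle_eq]
    refine (norm_sub_le _ _).trans ?_
    rw [Circle.norm_coe, Circle.norm_coe]
    norm_num
  have h1 : dist w ξ = dist w ξ ^ (1 - (α : ℝ)) * dist w ξ ^ (α : ℝ) := by
    rw [← Real.rpow_add' hd (by simp)]
    simp
  have h3 : dist w ξ ^ (1 - (α : ℝ)) ≤ 2 := by
    calc dist w ξ ^ (1 - (α : ℝ)) ≤ 2 ^ (1 - (α : ℝ)) :=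
          Real.rpow_le_rpow hd h2 (by linarith)
      _ ≤ 2 ^ (1 : ℝ) :=
          Real.rpow_le_rpow_of_exponent_le one_le_two (by linarith [α.coe_nonneg])
      _ = 2 := Real.rpow_one 2
  calc dist w ξ = dist w ξ ^ (1 - (α : ℝ)) * dist w ξ ^ (α : ℝ) := h1
    _ ≤ 2 * dist w ξ ^ (α : ℝ) := by gcongr

/-- Jordan's inequality: arcs of length at most `π` are at most `π / 2` times their chord. -/
theorem abs_arg_le_norm_sub_one (ζ : Circle) :
    |Complex.arg ζ| ≤ Real.pi / 2 * ‖(ζ : ℂ) - 1‖ := by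
  have h1 : ‖(ζ : ℂ) - 1‖ = ‖2 * Real.sin (Complex.arg ζ / 2)‖ := by
    rw [← Complex.norm_exp_I_mul_ofReal_sub_one]
    conv_lhs => rw [← Circle.exp_arg ζ, Circle.coe_exp]
    rw [mul_comm]
  have h2 : |Complex.arg ζ / 2| ≤ Real.pi / 2 := by
    rw [abs_div, abs_two]
    exact div_le_div_of_nonneg_right (Complex.abs_arg_le_pi _) zero_le_two
  have h3 := Real.mul_abs_le_abs_sin h2
  rw [abs_div, abs_two] at h3
  rw [h1, norm_mul, Real.norm_eq_abs, Real.norm_eq_abs, abs_two]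
  have hpi := Real.pi_pos
  calc |Complex.arg ζ| = Real.pi * (2 / Real.pi * (|Complex.arg ζ| / 2)) := by
        field_simp
    _ ≤ Real.pi * |Real.sin (Complex.arg ζ / 2)| := by gcongr
    _ = _ := by ring

theorem CircleDifferentiable.hasDerivAt {Φ : Circle → ℂ} (hΦ : CircleDifferentiable Φ)
    (w : Circle) (t : ℝ) :
    HasDerivAt (fun s : ℝ => Φ (Circle.exp s * w))
      (Complex.I * (Circle.exp t * w) * circleDeriv Φ (Circle.exp t * w)) t := by
  have h0 := (hΦ (Circle.exp t * w)).hasDerivAt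
  have hd : deriv (fun s : ℝ => Φ (Circle.exp s * (Circle.exp t * w))) 0 =
      Complex.I * (Circle.exp t * w) * circleDeriv Φ (Circle.exp t * w) := by
    have hne : Complex.I * ((Circle.exp t : ℂ) * w) ≠ 0 :=
      mul_ne_zero Complex.I_ne_zero (mul_ne_zero (Circle.coe_ne_zero _) (Circle.coe_ne_zero _))
    rw [circleDeriv, Circle.coe_mul, mul_div_cancel₀ _ hne]
  rw [hd, ← sub_self t] at h0
  refine (h0.comp_sub_const t t).congr_of_eventuallyEq (Eventually.of_forall fun s => ?_)
  simp only
  rw [← mul_assoc, ← Circle.exp_add, sub_add_cancel]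

/-- The derivative along the circle is determined by the derivative in the angle. -/
theorem circleDeriv_eq_of_hasDerivAt {Φ : Circle → ℂ} {w : Circle} {d : ℂ}
    (h : HasDerivAt (fun t : ℝ => Φ (Circle.exp t * w)) (Complex.I * w * d) 0) :
    circleDeriv Φ w = d := by
  rw [circleDeriv, h.deriv, mul_div_cancel_left₀ _
    (mul_ne_zero Complex.I_ne_zero (Circle.coe_ne_zero w))]

open Classical in
/-- The difference quotient of `Φ` between `w` and `ζ w`, extended by `Φ'(w)` to `ζ = 1`. -/
def diffQuot (Φ : Circle → ℂ) (ζ w : Circle) : ℂ :=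
  if ζ = 1 then circleDeriv Φ w else (Φ (ζ * w) - Φ w) / (ζ * w - w)

theorem coe_mul_sub_ne_zero {ζ : Circle} (hζ : ζ ≠ 1) (w : Circle) : (ζ : ℂ) * w - w ≠ 0 := by
  rw [sub_ne_zero, ← Circle.coe_mul, Ne, Circle.coe_inj]
  simpa using hζ

theorem diffQuot_mul {Φ : Circle → ℂ} {ζ : Circle} (hζ : ζ ≠ 1) (w : Circle) :
    diffQuot Φ ζ w * (ζ * w - w) = Φ (ζ * w) - Φ w := by
  rw [diffQuot, if_neg hζ, div_mul_cancel₀ _ (coe_mul_sub_ne_zero hζ w)]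

theorem diffQuot_one (Φ : Circle → ℂ) (w : Circle) : diffQuot Φ 1 w = circleDeriv Φ w :=
  if_pos rfl

theorem diffQuot_add {Φ Ψ : Circle → ℂ} (hΦ : CircleDifferentiable Φ)
    (hΨ : CircleDifferentiable Ψ) (ζ w : Circle) :
    diffQuot (Φ + Ψ) ζ w = diffQuot Φ ζ w + diffQuot Ψ ζ w := by
  by_cases hζ : ζ = 1
  · simp only [diffQuot, if_pos hζ, circleDeriv_add hΦ hΨ, Pi.add_apply]
  · simp only [diffQuot, if_neg hζ, Pi.add_apply, ← add_div]
    congr 1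
    ring

theorem diffQuot_smul (c : ℝ) {Φ : Circle → ℂ} (hΦ : CircleDifferentiable Φ) (ζ w : Circle) :
    diffQuot (c • Φ) ζ w = c • diffQuot Φ ζ w := by
  by_cases hζ : ζ = 1
  · simp only [diffQuot, if_pos hζ, circleDeriv_smul c hΦ, Pi.smul_apply]
  · simp only [diffQuot, if_neg hζ, Pi.smul_apply, ← smul_sub, smul_div_assoc]

theorem one_le_pi_div_two : 1 ≤ Real.pi / 2 := by linarith [Real.pi_gt_three]

theorem norm_diffQuot_le {Φ : Circle → ℂ} (hΦ : CircleDifferentiable Φ) {M : ℝ}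
    (hM : ∀ w, ‖circleDeriv Φ w‖ ≤ M) (ζ w : Circle) : ‖diffQuot Φ ζ w‖ ≤ Real.pi / 2 * M := by
  have hM0 : 0 ≤ M := (norm_nonneg _).trans (hM w)
  by_cases hζ : ζ = 1
  · rw [hζ, diffQuot_one]
    exact (hM w).trans (le_mul_of_one_le_left hM0 one_le_pi_div_two)
  have hmv := Convex.norm_image_sub_le_of_norm_hasDerivWithin_le (s := univ) (C := M)
    (f := fun s : ℝ => Φ (Circle.exp s * w)) (x := 0) (y := Complex.arg ζ)
    (fun t _ => (hΦ.hasDerivAt w t).hasDerivWithinAt)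
    (fun t _ => by
      rw [norm_mul, norm_mul, norm_mul, Complex.norm_I, Circle.norm_coe, Circle.norm_coe, one_mul,
        one_mul, one_mul]
      exact hM _) convex_univ (mem_univ _) (mem_univ _)
  simp only [Circle.exp_arg, Circle.exp_zero, one_mul, sub_zero, Real.norm_eq_abs] at hmv
  have hpos : 0 < ‖(ζ : ℂ) - 1‖ := norm_pos_iff.2 (sub_ne_zero.2 fun h => hζ (Circle.ext h))
  rw [diffQuot, if_neg hζ, norm_div, ← sub_one_mul, norm_mul, Circle.norm_coe, mul_one,
    div_le_iff₀ hpos]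
  calc _ ≤ M * |Complex.arg ζ| := hmv
    _ ≤ M * (Real.pi / 2 * ‖(ζ : ℂ) - 1‖) := by gcongr; exact abs_arg_le_norm_sub_one ζ
    _ = _ := by ring

/-- Rotating both points along the same arc shows that the difference quotient is as Hölder in `w`,
for fixed `ζ`, as the derivative. -/
theorem norm_diffQuot_sub_le {Φ : Circle → ℂ} (hΦ : CircleDifferentiable Φ) {w ξ : Circle} {M : ℝ}
    (hM : ∀ ζ, ‖circleDeriv Φ (ζ * w) - circleDeriv Φ (ζ * ξ)‖ ≤ M) (ζ : Circle) :
    ‖diffQuot Φ ζ w - diffQuot Φ ζ ξ‖ ≤ Real.pi / 2 * M := by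
  have hM0 : 0 ≤ M := (norm_nonneg _).trans (hM 1)
  by_cases hζ : ζ = 1
  · rw [hζ, diffQuot_one, diffQuot_one]
    have h := hM 1
    rw [one_mul, one_mul] at h
    exact h.trans (le_mul_of_one_le_left hM0 one_le_pi_div_two)
  have hne : ∀ u : Circle, (u : ℂ) ≠ 0 := Circle.coe_ne_zero
  have hder : ∀ t : ℝ, HasDerivAt
      (fun s : ℝ => Φ (Circle.exp s * w) / w - Φ (Circle.exp s * ξ) / ξ)
      (Complex.I * Circle.exp t *
        (circleDeriv Φ (Circle.exp t * w) - circleDeriv Φ (Circle.exp t * ξ))) t := by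
    intro t
    refine (((hΦ.hasDerivAt w t).div_const (w : ℂ)).sub
      ((hΦ.hasDerivAt ξ t).div_const (ξ : ℂ))).congr_deriv ?_
    have hw := hne w
    have hξ := hne ξ
    field_simp
  have hmv := Convex.norm_image_sub_le_of_norm_hasDerivWithin_le (s := univ) (C := M)
    (x := 0) (y := Complex.arg ζ) (fun t _ => (hder t).hasDerivWithinAt)
    (fun t _ => by simpa using hM (Circle.exp t)) convex_univ (mem_univ _) (mem_univ _)
  simp only [Circle.exp_arg, Circle.exp_zero, one_mul, sub_zero, Real.norm_eq_abs] at hmv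
  have h1 : (ζ : ℂ) - 1 ≠ 0 := sub_ne_zero.2 fun h => hζ (Circle.ext h)
  have hpos : 0 < ‖(ζ : ℂ) - 1‖ := norm_pos_iff.2 h1
  have heq : diffQuot Φ ζ w - diffQuot Φ ζ ξ =
      (Φ (ζ * w) / w - Φ (ζ * ξ) / ξ - (Φ w / w - Φ ξ / ξ)) / (ζ - 1) := by
    rw [diffQuot, diffQuot, if_neg hζ, if_neg hζ, ← sub_one_mul, ← sub_one_mul]
    field_simp [hne w, hne ξ]
    ring
  rw [heq, norm_div, div_le_iff₀ hpos]
  calc _ ≤ M * |Complex.arg ζ| := hmv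
    _ ≤ M * (Real.pi / 2 * ‖(ζ : ℂ) - 1‖) := by gcongr; exact abs_arg_le_norm_sub_one ζ
    _ = _ := by ring

theorem measurable_diffQuot {Φ : Circle → ℂ} (hΦ : Continuous Φ) (w : Circle) :
    Measurable fun θ : ℝ => diffQuot Φ (Circle.exp θ) w := by
  have h : Continuous (Circle.exp : ℝ → Circle) := Circle.exp.continuous
  refine Measurable.ite (p := fun θ : ℝ => Circle.exp θ = 1) ?_ measurable_const ?_
  · exact (isClosed_eq h continuous_const).measurableSet
  · refine Measurable.div ?_ ?_
    · exact ((hΦ.comp (h.mul continuous_const)).sub continuous_const).measurable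
    · exact (((continuous_circle_coe.comp h).mul continuous_const).sub continuous_const).measurable

/-! ### Bounded linear maps between the function spaces -/

namespace C1Holder

variable {α : ℝ≥0}

theorem coe_add (f g : C1Holder α) : ⇑(f + g) = f + g := rfl

theorem coe_smul (c : ℝ) (f : C1Holder α) : ⇑(c • f) = c • ⇑f := rfl

theorem circleDifferentiable_coe (f : C1Holder α) : CircleDifferentiable f :=
  f.circleDifferentiable

protected theorem continuous (f : C1Holder α) : Continuous f := (toCont f).continuous

theorem norm_apply_le (f : C1Holder α) (w : Circle) : ‖f w‖ ≤ ‖f‖ :=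
  ((toCont f).norm_coe_le_norm w).trans <| by
    rw [norm_def]; exact le_add_of_nonneg_right (norm_nonneg _)

theorem norm_derivL_le (f : C1Holder α) : ‖derivL f‖ ≤ ‖f‖ := by
  rw [norm_def]; exact le_add_of_nonneg_left (norm_nonneg _)

/-- The derivative as a bounded linear map. -/
def derivCLM : C1Holder α →L[ℝ] HolderSpace α ℂ :=
  derivL.mkContinuous 1 fun f => by rw [one_mul]; exact f.norm_derivL_le

@[simp]
theorem derivCLM_apply (f : C1Holder α) (w : Circle) : derivCLM f w = circleDeriv f w := rfl

theorem norm_circleDeriv_le (f : C1Holder α) (w : Circle) : ‖circleDeriv f w‖ ≤ ‖f‖ :=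
  ((derivL f).norm_apply_le w).trans f.norm_derivL_le

theorem norm_circleDeriv_sub_le (f : C1Holder α) (w ξ : Circle) :
    ‖circleDeriv f w - circleDeriv f ξ‖ ≤ ‖f‖ * dist w ξ ^ (α : ℝ) :=
  ((derivL f).norm_sub_le w ξ).trans <| by gcongr; exact f.norm_derivL_le

theorem norm_circleDeriv_mul_sub_le (f : C1Holder α) (ζ w ξ : Circle) :
    ‖circleDeriv f (ζ * w) - circleDeriv f (ζ * ξ)‖ ≤ ‖f‖ * dist w ξ ^ (α : ℝ) := by
  rw [← dist_circle_mul_left ζ w ξ]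
  exact f.norm_circleDeriv_sub_le _ _

theorem norm_diffQuot_le (f : C1Holder α) (ζ w : Circle) :
    ‖diffQuot f ζ w‖ ≤ Real.pi / 2 * ‖f‖ :=
  VState.norm_diffQuot_le f.circleDifferentiable_coe f.norm_circleDeriv_le ζ w

theorem norm_diffQuot_sub_le (f : C1Holder α) (ζ w ξ : Circle) :
    ‖diffQuot f ζ w - diffQuot f ζ ξ‖ ≤ Real.pi / 2 * ‖f‖ * dist w ξ ^ (α : ℝ) := by
  rw [mul_assoc]
  exact VState.norm_diffQuot_sub_le f.circleDifferentiable_coe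
    (fun ζ => f.norm_circleDeriv_mul_sub_le ζ w ξ) ζ

/-- The difference quotient as a bounded linear map into the kernel algebra. -/
def diffQuotCLM (hα : 0 < α) : C1Holder α →L[ℝ] Kernel α :=
  Kernel.mkCLM hα (fun f => diffQuot f) (Real.pi / 2) (by positivity)
    (fun f g => diffQuot_add f.circleDifferentiable_coe g.circleDifferentiable_coe)
    (fun c f => diffQuot_smul c f.circleDifferentiable_coe)
    norm_diffQuot_le norm_diffQuot_sub_le (fun f => measurable_diffQuot f.continuous)

@[simp]
theorem diffQuotCLM_apply (hα : 0 < α) (f : C1Holder α) (ζ w : Circle) :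
    diffQuotCLM hα f ζ w = diffQuot f ζ w := rfl

/-- The complex conjugate of the difference quotient. -/
def conjDiffQuotCLM (hα : 0 < α) : C1Holder α →L[ℝ] Kernel α :=
  Kernel.mkCLM hα (fun f ζ w => starRingEnd ℂ (diffQuot f ζ w)) (Real.pi / 2) (by positivity)
    (fun f g ζ w => by
      rw [coe_add, diffQuot_add f.circleDifferentiable_coe g.circleDifferentiable_coe, map_add])
    (fun c f ζ w => by
      rw [coe_smul, diffQuot_smul c f.circleDifferentiable_coe, Complex.real_smul, map_mul,
        Complex.conj_ofReal, Complex.real_smul])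
    (fun f ζ w => by rw [RCLike.norm_conj]; exact f.norm_diffQuot_le ζ w)
    (fun f ζ w ξ => by rw [← map_sub, RCLike.norm_conj]; exact f.norm_diffQuot_sub_le ζ w ξ)
    (fun f w => Complex.continuous_conj.measurable.comp (measurable_diffQuot f.continuous w))

@[simp]
theorem conjDiffQuotCLM_apply (hα : 0 < α) (f : C1Holder α) (ζ w : Circle) :
    conjDiffQuotCLM hα f ζ w = starRingEnd ℂ (diffQuot f ζ w) := rfl

/-- The derivative at the second point, `(ζ, w) ↦ f'(ζ w)`. -/
def rotDerivCLM (hα : 0 < α) : C1Holder α →L[ℝ] Kernel α :=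
  Kernel.mkCLM hα (fun f ζ w => circleDeriv f (ζ * w)) 1 zero_le_one
    (fun f g ζ w => by
      rw [coe_add, circleDeriv_add f.circleDifferentiable_coe g.circleDifferentiable_coe, Pi.add_apply])
    (fun c f ζ w => by rw [coe_smul, circleDeriv_smul c f.circleDifferentiable_coe, Pi.smul_apply])
    (fun f ζ w => by rw [one_mul]; exact f.norm_circleDeriv_le _)
    (fun f ζ w ξ => by rw [one_mul]; exact f.norm_circleDeriv_mul_sub_le ζ w ξ)
    (fun f w => ((derivL f).continuous.comp
      (Circle.exp.continuous.mul continuous_const)).measurable)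

@[simp]
theorem rotDerivCLM_apply (hα : 0 < α) (f : C1Holder α) (ζ w : Circle) :
    rotDerivCLM hα f ζ w = circleDeriv f (ζ * w) := rfl

theorem norm_sub_le (f : C1Holder α) (w ξ : Circle) :
    ‖f w - f ξ‖ ≤ Real.pi / 2 * ‖f‖ * dist w ξ := by
  by_cases h : w = ξ
  · simp [h]
  have hζ : w / ξ ≠ 1 := fun h' => h (div_eq_one.1 h')
  have h1 := diffQuot_mul (Φ := f) hζ ξ
  rw [← Circle.coe_mul, div_mul_cancel] at h1
  rw [← h1, norm_mul, ← dist_circle_eq]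
  gcongr
  exact f.norm_diffQuot_le _ _

/-- The conjugation `f ↦ conj f`, as a bounded linear map from `C^{1+α}` to `C^α`. -/
def conjCLM (hα : 0 < α) (hα1 : α < 1) : C1Holder α →L[ℝ] HolderSpace α ℂ :=
  HolderSpace.mkCLM hα (fun f w => starRingEnd ℂ (f w)) Real.pi Real.pi_pos.le
    (fun f g w => by rw [coe_add, Pi.add_apply, map_add])
    (fun c f w => by
      rw [coe_smul, Pi.smul_apply, Complex.real_smul, map_mul, Complex.conj_ofReal,
        Complex.real_smul])
    (fun f w => by
      rw [RCLike.norm_conj]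
      exact (f.norm_apply_le w).trans
        (le_mul_of_one_le_left (norm_nonneg _) (by linarith [Real.pi_gt_three])))
    (fun f w ξ => by
      rw [← map_sub, RCLike.norm_conj]
      refine (f.norm_sub_le w ξ).trans ?_
      have hpi := Real.pi_pos
      calc Real.pi / 2 * ‖f‖ * dist w ξ
          ≤ Real.pi / 2 * ‖f‖ * (2 * dist w ξ ^ (α : ℝ)) := by
            gcongr
            exact dist_circle_le_rpow hα1 w ξ
        _ = _ := by ring)

@[simp]
theorem conjCLM_apply (hα : 0 < α) (hα1 : α < 1) (f : C1Holder α) (w : Circle) :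
    conjCLM hα hα1 f w = starRingEnd ℂ (f w) := rfl

end C1Holder

namespace Kernel

variable {α : ℝ≥0}

theorem intervalIntegrable (k : Kernel α) (w : Circle) :
    IntervalIntegrable (fun θ : ℝ => k (Circle.exp θ) w) MeasureTheory.volume 0
      (2 * Real.pi) :=
  (intervalIntegrable_const (c := ‖k‖)).mono_fun (k.measurable w).aestronglyMeasurable
    (Eventually.of_forall fun θ => by
      rw [norm_norm]; exact k.norm_apply_apply_le _ _)

/-- Integration of a kernel over the first variable. -/
def integralCLM (hα : 0 < α) : Kernel α →L[ℝ] HolderSpace α ℂ :=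
  HolderSpace.mkCLM hα (fun k w => ∫ θ in (0 : ℝ)..(2 * Real.pi), k (Circle.exp θ) w)
    (2 * Real.pi) (by positivity)
    (fun k l w => by
      simp only [add_apply]
      exact intervalIntegral.integral_add (k.intervalIntegrable w) (l.intervalIntegrable w))
    (fun c k w => by
      simp only [smul_apply]
      exact intervalIntegral.integral_smul c _)
    (fun k w => by
      have h := intervalIntegral.norm_integral_le_of_norm_le_const (a := 0) (b := 2 * Real.pi)
        (C := ‖k‖) (f := fun θ => k (Circle.exp θ) w) fun θ _ => k.norm_apply_apply_le _ _
      rwa [sub_zero, abs_of_pos Real.two_pi_pos, mul_comm ‖k‖] at h)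
    (fun k w ξ => by
      rw [← intervalIntegral.integral_sub (k.intervalIntegrable w) (k.intervalIntegrable ξ)]
      have h := intervalIntegral.norm_integral_le_of_norm_le_const (a := 0) (b := 2 * Real.pi)
        (C := ‖k‖ * dist w ξ ^ (α : ℝ))
        (f := fun θ => k (Circle.exp θ) w - k (Circle.exp θ) ξ) fun θ _ =>
          ((k (Circle.exp θ)).norm_sub_le w ξ).trans (by gcongr; exact k.norm_apply_le _)
      rwa [sub_zero, abs_of_pos Real.two_pi_pos, mul_comm _ (2 * Real.pi), ← mul_assoc] at h)

@[simp]
theorem integralCLM_apply (hα : 0 < α) (k : Kernel α) (w : Circle) :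
    integralCLM hα k w = ∫ θ in (0 : ℝ)..(2 * Real.pi), k (Circle.exp θ) w := rfl

end Kernel

/-! ### The functional without singular kernel -/

theorem diffQuot_ne_zero_iff {Φ : Circle → ℂ} {w ξ : Circle} (h : ξ ≠ w) :
    diffQuot Φ (ξ / w) w ≠ 0 ↔ Φ ξ ≠ Φ w := by
  have hζ : ξ / w ≠ 1 := fun h' => h (div_eq_one.1 h')
  have h1 := diffQuot_mul (Φ := Φ) hζ w
  have h2 := coe_mul_sub_ne_zero hζ w
  rw [div_mul_cancel] at h1
  rw [← sub_ne_zero (a := Φ ξ), ← h1, mul_ne_zero_iff_right h2]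

/-- In the variables `w` and `ζ = ξ / w` the integrand is a product of difference quotients, because
`conj (ξ - w) / (ξ - w) = -1 / (ξ w)` on the circle. -/
theorem cauchyIntegrand_mul_eq {Φ : Circle → ℂ} {ζ : Circle} (hζ : ζ ≠ 1) (w : Circle) :
    cauchyIntegrand Φ w (ζ * w) * (Complex.I * ((ζ * w : Circle) : ℂ)) =
      -Complex.I / w * (starRingEnd ℂ (diffQuot Φ ζ w) * (diffQuot Φ ζ w)⁻¹ *
        circleDeriv Φ (ζ * w)) := by
  have h1 := diffQuot_mul (Φ := Φ) hζ w
  have h2 : starRingEnd ℂ (Φ (ζ * w)) - starRingEnd ℂ (Φ w) =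
      starRingEnd ℂ (diffQuot Φ ζ w) * (((ζ : ℂ) * w)⁻¹ - (w : ℂ)⁻¹) := by
    rw [← map_sub, ← h1, map_mul, map_sub, ← Circle.coe_mul, ← Circle.coe_inv_eq_conj,
      ← Circle.coe_inv_eq_conj, Circle.coe_inv, Circle.coe_inv]
  have hz := Circle.coe_ne_zero ζ
  have hw := Circle.coe_ne_zero w
  have h3 := coe_mul_sub_ne_zero hζ w
  have h4 : ((ζ : ℂ) * w)⁻¹ - (w : ℂ)⁻¹ = -(ζ * w - w) * (ζ * w * w : ℂ)⁻¹ := by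
    field_simp
    ring
  rw [cauchyIntegrand, h2, ← h1, h4, Circle.coe_mul, div_eq_mul_inv, mul_inv]
  set a := (ζ : ℂ) * w - w
  field_simp

/-- The integral over the circle is invariant under rotations. -/
theorem integral_circle_mul_right {E : Type*} [NormedAddCommGroup E] [NormedSpace ℝ E]
    (h : Circle → E) (w : Circle) :
    ∫ θ in (0 : ℝ)..(2 * Real.pi), h (Circle.exp θ * w) =
      ∫ θ in (0 : ℝ)..(2 * Real.pi), h (Circle.exp θ) := by
  have hper : Function.Periodic (fun θ : ℝ => h (Circle.exp θ)) (2 * Real.pi) := fun θ => by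
    simp only [Circle.periodic_exp θ]
  have h1 := intervalIntegral.integral_comp_add_right (a := 0) (b := 2 * Real.pi)
    (fun θ : ℝ => h (Circle.exp θ)) (Complex.arg w)
  have h2 := hper.intervalIntegral_add_eq (Complex.arg w) 0
  simp only [Circle.exp_add, Circle.exp_arg] at h1
  rw [h1, zero_add, add_comm, h2, zero_add]

theorem exp_ne_one_of_mem_Ioo {θ : ℝ} (hθ : θ ∈ Ioo 0 (2 * Real.pi)) : Circle.exp θ ≠ 1 := by
  intro h
  obtain ⟨n, hn⟩ := Circle.exp_eq_one.1 h
  have hpi := Real.two_pi_pos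
  rw [hn] at hθ
  have h0 : (0 : ℝ) < n := pos_of_mul_pos_left hθ.1 hpi.le
  have h1 : (n : ℝ) < 1 := by
    by_contra! h'
    nlinarith [hθ.2]
  norm_cast at h0 h1
  omega

/-- Integrals over the circle may be compared away from `ζ = 1`. -/
theorem integral_circle_congr {E : Type*} [NormedAddCommGroup E] [NormedSpace ℝ E]
    {f g : Circle → E} (h : ∀ ζ, ζ ≠ 1 → f ζ = g ζ) :
    ∫ θ in (0 : ℝ)..(2 * Real.pi), f (Circle.exp θ) =
      ∫ θ in (0 : ℝ)..(2 * Real.pi), g (Circle.exp θ) := by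
  rw [intervalIntegral.integral_of_le Real.two_pi_pos.le,
    intervalIntegral.integral_of_le Real.two_pi_pos.le,
    MeasureTheory.integral_Ioc_eq_integral_Ioo, MeasureTheory.integral_Ioc_eq_integral_Ioo]
  exact MeasureTheory.setIntegral_congr_fun measurableSet_Ioo fun θ hθ =>
    h _ (exp_ne_one_of_mem_Ioo hθ)

theorem circleMean_cauchyIntegrand (Φ : Circle → ℂ) (w : Circle) :
    circleMean (cauchyIntegrand Φ w) * w = -((2 * Real.pi)⁻¹ : ℝ) *
      ∫ θ in (0 : ℝ)..(2 * Real.pi), starRingEnd ℂ (diffQuot Φ (Circle.exp θ) w) *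
        (diffQuot Φ (Circle.exp θ) w)⁻¹ * circleDeriv Φ (Circle.exp θ * w) := by
  have h1 := integral_circle_mul_right
    (fun ξ : Circle => cauchyIntegrand Φ w ξ * (Complex.I * (ξ : ℂ))) w
  have h2 := integral_circle_congr
    (f := fun ζ : Circle => cauchyIntegrand Φ w (ζ * w) * (Complex.I * ((ζ * w : Circle) : ℂ)))
    (fun ζ hζ => cauchyIntegrand_mul_eq hζ w)
  rw [circleMean, ← h1, h2, intervalIntegral.integral_const_mul]
  have hw := Circle.coe_ne_zero w
  have hpi : (Real.pi : ℂ) ≠ 0 := by exact_mod_cast Real.pi_ne_zero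
  push_cast
  field_simp [Complex.I_ne_zero]

section Smooth

variable {α : ℝ≥0}

/-- The inclusion of the circle into `ℂ`, as a Hölder function. -/
def holderCoe (hα : 0 < α) (hα1 : α < 1) : HolderSpace α ℂ :=
  HolderSpace.ofBound hα (fun w => (w : ℂ)) ⟨2, zero_le_two, fun w ξ => by
    rw [← dist_circle_eq]; exact dist_circle_le_rpow hα1 w ξ⟩

/-- The functional `G`, written with bounded linear maps, products, and the inverse in the kernel
algebra. -/
def smoothG (hα : 0 < α) (hα1 : α < 1) (Ω : ℝ) (Φ : C1Holder α) : HolderSpace α ℂ :=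
  (2 * Ω) • (C1Holder.conjCLM hα hα1 Φ * holderCoe hα hα1 * C1Holder.derivCLM Φ) -
    (2 * Real.pi)⁻¹ • (Kernel.integralCLM hα (C1Holder.conjDiffQuotCLM hα Φ *
      Ring.inverse (C1Holder.diffQuotCLM hα Φ) * C1Holder.rotDerivCLM hα Φ) *
        C1Holder.derivCLM Φ)

theorem smoothG_apply (hα : 0 < α) (hα1 : α < 1) (Ω : ℝ) {Φ : C1Holder α}
    (hΦ : IsUnit (C1Holder.diffQuotCLM hα Φ)) (w : Circle) :
    smoothG hα hα1 Ω Φ w = G Ω Φ w := by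
  have h := circleMean_cauchyIntegrand Φ w
  rw [G, add_mul, h]
  simp only [smoothG, HolderSpace.sub_apply, HolderSpace.smul_apply, HolderSpace.mul_apply,
    C1Holder.conjCLM_apply, C1Holder.derivCLM_apply, Kernel.integralCLM_apply, Kernel.mul_apply,
    Kernel.inverse_apply hΦ, C1Holder.conjDiffQuotCLM_apply, C1Holder.diffQuotCLM_apply,
    C1Holder.rotDerivCLM_apply, holderCoe, HolderSpace.ofBound_apply, Complex.real_smul]
  push_cast
  ring

theorem contDiffAt_smoothG (hα : 0 < α) (hα1 : α < 1) {n : WithTop ℕ∞} {p : ℝ × C1Holder α}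
    (hp : IsUnit (C1Holder.diffQuotCLM hα p.2)) :
    ContDiffAt ℝ n (fun p : ℝ × C1Holder α => smoothG hα hα1 p.1 p.2) p := by
  have hL : ∀ {V : Type} [NormedAddCommGroup V] [NormedSpace ℝ V] (L : C1Holder α →L[ℝ] V),
      ContDiffAt ℝ n (fun p : ℝ × C1Holder α => L p.2) p := fun L =>
    (L.comp (ContinuousLinearMap.snd ℝ ℝ (C1Holder α))).contDiff.contDiffAt
  have hinv : ContDiffAt ℝ n
      (fun p : ℝ × C1Holder α => Ring.inverse (C1Holder.diffQuotCLM hα p.2)) p := by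
    obtain ⟨u, hu⟩ := hp
    have h1 := contDiffAt_ringInverse ℝ (n := n) u
    rw [hu] at h1
    exact h1.comp p (hL (C1Holder.diffQuotCLM hα))
  have hk := ((hL (C1Holder.conjDiffQuotCLM hα)).mul hinv).mul (hL (C1Holder.rotDerivCLM hα))
  have hint := (Kernel.integralCLM hα).contDiff.contDiffAt.comp p hk
  refine ContDiffAt.sub ?_ ?_
  · have hΩ : ContDiffAt ℝ n (fun p : ℝ × C1Holder α => 2 * p.1) p :=
      contDiffAt_const.mul contDiffAt_fst
    exact hΩ.smul
      (((hL (C1Holder.conjCLM hα hα1)).mul contDiffAt_const).mul (hL C1Holder.derivCLM))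
  · exact (hint.mul (hL C1Holder.derivCLM)).const_smul _

end Smooth

/-! ### The perturbed ellipses -/

section Ellipse

variable {α : ℝ≥0}

theorem hasDerivAt_exp_mul (w : Circle) :
    HasDerivAt (fun t : ℝ => ((Circle.exp t * w : Circle) : ℂ)) (Complex.I * w) 0 := by
  have h1 : HasDerivAt (fun t : ℝ => (t : ℂ) * Complex.I) (1 * Complex.I) 0 :=
    (Complex.ofRealCLM.hasDerivAt (x := (0 : ℝ))).mul_const Complex.I
  have h2 := h1.cexp.mul_const (w : ℂ)
  simpa [Circle.coe_exp] using h2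

theorem hasDerivAt_inv_exp_mul (w : Circle) :
    HasDerivAt (fun t : ℝ => (((Circle.exp t * w)⁻¹ : Circle) : ℂ))
      (Complex.I * w * -(((w⁻¹ : Circle) : ℂ) * ((w⁻¹ : Circle) : ℂ))) 0 := by
  have h := (hasDerivAt_exp_mul w).inv (by simp)
  simp only [Circle.coe_inv] at h ⊢
  refine h.congr_deriv ?_
  rw [Circle.exp_zero, one_mul]
  have hw := Circle.coe_ne_zero w
  field_simp

/-- The inclusion of the circle into `ℂ`, as a `C^{1+α}` function. -/
def c1Coe (α : ℝ≥0) : C1Holder α :=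
  ⟨⟨fun w => (w : ℂ), continuous_circle_coe⟩, fun w => (hasDerivAt_exp_mul w).differentiableAt, by
    have h : circleDeriv (fun w : Circle => (w : ℂ)) = fun _ => 1 := funext fun w =>
      circleDeriv_eq_of_hasDerivAt (by simpa using hasDerivAt_exp_mul w)
    exact ⟨h ▸ continuous_const, h ▸ memHolder_const'⟩⟩

@[simp]
theorem c1Coe_apply (w : Circle) : c1Coe α w = w := rfl

theorem circleDeriv_c1Coe (w : Circle) : circleDeriv (c1Coe α) w = 1 :=
  circleDeriv_eq_of_hasDerivAt (by simpa using hasDerivAt_exp_mul w)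

/-- The inverse, or complex conjugate, of the inclusion of the circle into `ℂ`, as a `C^{1+α}`
function. -/
def c1Inv (hα : 0 < α) (hα1 : α < 1) : C1Holder α :=
  ⟨⟨fun w => ((w⁻¹ : Circle) : ℂ), continuous_circle_coe.comp continuous_inv⟩,
    fun w => (hasDerivAt_inv_exp_mul w).differentiableAt, by
    let v : HolderSpace α ℂ := HolderSpace.ofBound hα (fun w => ((w⁻¹ : Circle) : ℂ))
      ⟨2, zero_le_two, fun w ξ => by
        rw [← dist_circle_eq, dist_circle_inv_inv]; exact dist_circle_le_rpow hα1 w ξ⟩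
    have h : circleDeriv (fun w : Circle => ((w⁻¹ : Circle) : ℂ)) = ⇑(-(v * v)) :=
      funext fun w => circleDeriv_eq_of_hasDerivAt (hasDerivAt_inv_exp_mul w)
    exact ⟨h ▸ (-(v * v)).continuous, h ▸ (-(v * v)).memHolder⟩⟩

@[simp]
theorem c1Inv_apply (hα : 0 < α) (hα1 : α < 1) (w : Circle) :
    c1Inv hα hα1 w = ((w⁻¹ : Circle) : ℂ) := rfl

theorem circleDeriv_c1Inv (hα : 0 < α) (hα1 : α < 1) (w : Circle) :
    circleDeriv (c1Inv hα hα1) w = -(((w⁻¹ : Circle) : ℂ) * ((w⁻¹ : Circle) : ℂ)) :=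
  circleDeriv_eq_of_hasDerivAt (hasDerivAt_inv_exp_mul w)

theorem diffQuot_c1Coe (ζ w : Circle) : diffQuot (c1Coe α) ζ w = 1 := by
  by_cases hζ : ζ = 1
  · rw [hζ, diffQuot_one, circleDeriv_c1Coe]
  · rw [diffQuot, if_neg hζ, c1Coe_apply, c1Coe_apply, Circle.coe_mul,
      div_self (coe_mul_sub_ne_zero hζ w)]

theorem norm_diffQuot_c1Inv (hα : 0 < α) (hα1 : α < 1) (ζ w : Circle) :
    ‖diffQuot (c1Inv hα hα1) ζ w‖ = 1 := by
  by_cases hζ : ζ = 1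
  · rw [hζ, diffQuot_one, circleDeriv_c1Inv, norm_neg, norm_mul, Circle.norm_coe, one_mul]
  · rw [diffQuot, if_neg hζ, c1Inv_apply, c1Inv_apply, norm_div, ← dist_circle_eq,
      dist_circle_inv_inv, dist_circle_eq, Circle.coe_mul,
      div_self (norm_ne_zero_iff.2 (coe_mul_sub_ne_zero hζ w))]

/-- The parametrization `Φ_f = w + Q / w + f` as an element of `C^{1+α}`. -/
def phiC1 (hα : 0 < α) (hα1 : α < 1) (p : ℝ × X α) : C1Holder α :=
  c1Coe α + p.1 • c1Inv hα hα1 + p.2.1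

theorem coe_phiC1 (hα : 0 < α) (hα1 : α < 1) (p : ℝ × X α) :
    ⇑(phiC1 hα hα1 p) = Phi p.1 p.2.1 := by
  funext w
  change (w : ℂ) + p.1 • ((w⁻¹ : Circle) : ℂ) + p.2.1 w = _
  rw [Phi, Circle.coe_inv, Complex.real_smul, div_eq_mul_inv]

theorem contDiff_phiC1 (hα : 0 < α) (hα1 : α < 1) {n : WithTop ℕ∞} :
    ContDiff ℝ n (phiC1 hα hα1) :=
  (contDiff_const.add (contDiff_fst.smul contDiff_const)).add
    ((X α).subtypeL.comp (ContinuousLinearMap.snd ℝ ℝ (X α))).contDiff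

/-- The difference quotients of the ellipse are at least `1 - Q` and those of `f` at most
`π / 2 * ‖f'‖`, where `π / 2 < 2`. -/
theorem le_norm_diffQuot_phiC1 (hα : 0 < α) (hα1 : α < 1) {ε : ℝ} {p : ℝ × X α}
    (hp : p ∈ domain α ε) (ζ w : Circle) :
    (1 - ε) * (1 - Real.pi / 4) ≤ ‖diffQuot (phiC1 hα hα1 p) ζ w‖ := by
  obtain ⟨⟨hQ0, hQ1⟩, hf⟩ := hp
  rw [mem_ball_zero_iff] at hf
  have hf' : ‖p.2.1‖ < (1 - ε) / 2 := hf
  have h1 : diffQuot (phiC1 hα hα1 p) ζ w =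
      1 + p.1 • diffQuot (c1Inv hα hα1) ζ w + diffQuot p.2.1 ζ w := by
    rw [phiC1, C1Holder.coe_add, diffQuot_add
        (c1Coe α + p.1 • c1Inv hα hα1).circleDifferentiable_coe p.2.1.circleDifferentiable_coe,
      C1Holder.coe_add, diffQuot_add (c1Coe α).circleDifferentiable_coe
        (p.1 • c1Inv hα hα1).circleDifferentiable_coe,
      C1Holder.coe_smul, diffQuot_smul _ (c1Inv hα hα1).circleDifferentiable_coe, diffQuot_c1Coe]
  have h2 : ‖p.1 • diffQuot (c1Inv hα hα1) ζ w‖ = p.1 := by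
    rw [norm_smul, norm_diffQuot_c1Inv, mul_one, Real.norm_of_nonneg hQ0.le]
  have h3 := p.2.1.norm_diffQuot_le ζ w
  have h4 : ‖(1 : ℂ)‖ ≤ ‖diffQuot (phiC1 hα hα1 p) ζ w‖ +
      (‖p.1 • diffQuot (c1Inv hα hα1) ζ w‖ + ‖diffQuot p.2.1 ζ w‖) := by
    have h5 : (1 : ℂ) = diffQuot (phiC1 hα hα1 p) ζ w -
        (p.1 • diffQuot (c1Inv hα hα1) ζ w + diffQuot p.2.1 ζ w) := by rw [h1]; ring
    conv_lhs => rw [h5]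
    exact (norm_sub_le _ _).trans (by gcongr; exact norm_add_le _ _)
  rw [norm_one, h2] at h4
  have hpi := Real.pi_pos
  have h6 : Real.pi / 2 * ‖p.2.1‖ ≤ Real.pi / 2 * ((1 - ε) / 2) := by gcongr
  linarith

theorem margin_pos {ε : ℝ} (hε1 : ε < 1) : 0 < (1 - ε) * (1 - Real.pi / 4) :=
  mul_pos (by linarith) (by linarith [Real.pi_lt_four])

theorem isUnit_diffQuotCLM_phiC1 (hα : 0 < α) (hα1 : α < 1) {ε : ℝ} (hε1 : ε < 1) {p : ℝ × X α}
    (hp : p ∈ domain α ε) : IsUnit (C1Holder.diffQuotCLM hα (phiC1 hα hα1 p)) :=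
  Kernel.isUnit_of_le_norm (margin_pos hε1) (le_norm_diffQuot_phiC1 hα hα1 hp)

theorem phi_ne_phi (hα : 0 < α) (hα1 : α < 1) {ε : ℝ} (hε1 : ε < 1) {p : ℝ × X α}
    (hp : p ∈ domain α ε) {ξ w : Circle} (h : ξ ≠ w) : Phi p.1 p.2.1 ξ ≠ Phi p.1 p.2.1 w := by
  rw [← coe_phiC1 hα hα1, ← diffQuot_ne_zero_iff h, ← norm_pos_iff]
  exact (margin_pos hε1).trans_le (le_norm_diffQuot_phiC1 hα hα1 hp _ _)

/-- The integrand is bounded, since `|conj z / z| ≤ 1` (also for `z = 0`). -/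
theorem intervalIntegrable_cauchyIntegrand (Φ : C1Holder α) (w : Circle) :
    IntervalIntegrable (fun θ : ℝ => cauchyIntegrand Φ w (Circle.exp θ) *
      (Complex.I * (Circle.exp θ : ℂ))) MeasureTheory.volume 0 (2 * Real.pi) := by
  have hexp : Continuous (Circle.exp : ℝ → Circle) := Circle.exp.continuous
  have h1 : Continuous fun θ : ℝ => Φ (Circle.exp θ) := Φ.continuous.comp hexp
  have h2 : Continuous fun θ : ℝ => circleDeriv Φ (Circle.exp θ) :=
    (C1Holder.derivL Φ).continuous.comp hexp
  refine (intervalIntegrable_const (c := ‖Φ‖)).mono_fun ?_ (Eventually.of_forall fun θ => ?_)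
  · refine Measurable.aestronglyMeasurable ?_
    refine Measurable.mul (Measurable.mul (Measurable.div ?_ ?_) h2.measurable) ?_
    · exact ((Complex.continuous_conj.comp h1).sub continuous_const).measurable
    · exact (h1.sub continuous_const).measurable
    · exact (continuous_const.mul (continuous_circle_coe.comp hexp)).measurable
  · beta_reduce
    rw [norm_mul, norm_mul, Complex.norm_I, Circle.norm_coe, mul_one, mul_one, cauchyIntegrand,
      norm_mul, norm_div, ← map_sub, RCLike.norm_conj, norm_norm]
    exact (mul_le_of_le_one_left (norm_nonneg _) (div_self_le_one _)).trans
      (Φ.norm_circleDeriv_le _)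

end Ellipse

/-! ### Pointwise convergence of sine series -/

/-- The Riemann-Lebesgue lemma on a bounded interval. -/
theorem tendsto_intervalIntegral_exp_mul (h : ℝ → ℂ) {a b : ℝ} (hab : a ≤ b) :
    Tendsto (fun x : ℝ => ∫ θ in a..b, Complex.exp (x * θ * Complex.I) * h θ)
      (cocompact ℝ) (𝓝 0) := by
  have hc : -(2 * Real.pi)⁻¹ ≠ 0 := by
    have := Real.pi_ne_zero
    simp [this]
  have h1 := (Real.tendsto_integral_exp_smul_cocompact ((Ioc a b).indicator h)).comp
    (Homeomorph.mulLeft₀ _ hc).isClosedEmbedding.tendsto_cocompact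
  refine h1.congr fun x => ?_
  rw [intervalIntegral.integral_of_le hab, ← MeasureTheory.integral_indicator measurableSet_Ioc]
  refine MeasureTheory.integral_congr_ae (Eventually.of_forall fun θ => ?_)
  simp only [Homeomorph.coe_mulLeft₀]
  by_cases hθ : θ ∈ Ioc a b
  · rw [indicator_of_mem hθ, indicator_of_mem hθ, Circle.smul_def, Real.fourierChar_apply,
      smul_eq_mul]
    congr 3
    have hpi : (Real.pi : ℂ) ≠ 0 := by exact_mod_cast Real.pi_ne_zero
    push_cast
    field_simp
  · rw [indicator_of_notMem hθ, indicator_of_notMem hθ, smul_zero]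

theorem periodic_comp_exp {E : Type*} (h : Circle → E) :
    Function.Periodic (fun θ : ℝ => h (Circle.exp θ)) (2 * Real.pi) := fun θ => by
  simp only [Circle.periodic_exp θ]

theorem integral_circle_eq_neg_pi_pi {E : Type*} [NormedAddCommGroup E] [NormedSpace ℝ E]
    (h : Circle → E) : ∫ θ in (0 : ℝ)..(2 * Real.pi), h (Circle.exp θ) =
      ∫ θ in (-Real.pi)..Real.pi, h (Circle.exp θ) := by
  have h1 := (periodic_comp_exp h).intervalIntegral_add_eq (-Real.pi) 0
  rw [zero_add, show -Real.pi + 2 * Real.pi = Real.pi by ring] at h1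
  exact h1.symm

/-- The integral over the circle is invariant under the reflection `ζ ↦ ζ⁻¹`. -/
theorem integral_circle_inv {E : Type*} [NormedAddCommGroup E] [NormedSpace ℝ E]
    (h : Circle → E) : ∫ θ in (0 : ℝ)..(2 * Real.pi), h (Circle.exp θ)⁻¹ =
      ∫ θ in (0 : ℝ)..(2 * Real.pi), h (Circle.exp θ) := by
  rw [integral_circle_eq_neg_pi_pi, integral_circle_eq_neg_pi_pi fun z => h z⁻¹]
  have h1 := intervalIntegral.integral_comp_neg (a := -Real.pi) (b := Real.pi)
    fun θ : ℝ => h (Circle.exp θ)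
  rw [neg_neg] at h1
  rw [← h1]
  simp only [Circle.exp_neg]

section Dini

variable {α : ℝ≥0}

/-- The quotient `(f(ζ w) - f(w)) / (ζ - 1)` of Dini's test. -/
def diniQuot (f : HolderSpace α ℝ) (w ζ : Circle) : ℂ :=
  ((f (ζ * w) - f w : ℝ) : ℂ) / ((ζ : ℂ) - 1)

theorem norm_diniQuot_le (f : HolderSpace α ℝ) (w : Circle) {θ : ℝ}
    (hθ : θ ∈ Ioc (-Real.pi) Real.pi) :
    ‖diniQuot f w (Circle.exp θ)‖ ≤ Real.pi / 2 * ‖f‖ * |θ| ^ ((α : ℝ) - 1) := by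
  rcases eq_or_ne θ 0 with rfl | h0
  · rw [diniQuot, Circle.exp_zero, Circle.coe_one, sub_self, div_zero, norm_zero]
    positivity
  have hpos : 0 < |θ| := abs_pos.2 h0
  have h1 := abs_arg_le_norm_sub_one (Circle.exp θ)
  rw [Circle.arg_exp hθ.1 hθ.2] at h1
  have h2 : ‖(Circle.exp θ : ℂ) - 1‖ ≤ |θ| := by
    have h := Real.norm_exp_I_mul_ofReal_sub_one_le (x := θ)
    rwa [mul_comm] at h
  have h3 := f.norm_sub_le (Circle.exp θ * w) w
  have h4 : dist (Circle.exp θ * w) w = ‖(Circle.exp θ : ℂ) - 1‖ := by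
    rw [dist_circle_eq, Circle.coe_mul, ← sub_one_mul, norm_mul, Circle.norm_coe, mul_one]
  rw [h4] at h3
  set d := ‖(Circle.exp θ : ℂ) - 1‖ with hd
  have hd0 : 0 < d := by
    by_contra! h
    nlinarith [Real.pi_pos]
  have h5 : d⁻¹ ≤ Real.pi / 2 * |θ|⁻¹ := by
    rw [inv_le_iff_one_le_mul₀ hd0]
    calc (1 : ℝ) = |θ|⁻¹ * |θ| := (inv_mul_cancel₀ hpos.ne').symm
      _ ≤ |θ|⁻¹ * (Real.pi / 2 * d) := by gcongr
      _ = _ := by ring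
  rw [diniQuot, norm_div, Complex.norm_real, ← hd, div_eq_mul_inv]
  calc ‖f (Circle.exp θ * w) - f w‖ * d⁻¹
      ≤ (‖f‖ * |θ| ^ (α : ℝ)) * (Real.pi / 2 * |θ|⁻¹) := by
        gcongr
        exact h3.trans (by gcongr)
    _ = Real.pi / 2 * ‖f‖ * |θ| ^ ((α : ℝ) - 1) := by
        rw [Real.rpow_sub_one hpos.ne', div_eq_mul_inv]
        ring

theorem intervalIntegrable_abs_rpow {r : ℝ} (hr : -1 < r) {a : ℝ} (ha : 0 ≤ a) :
    IntervalIntegrable (fun θ : ℝ => |θ| ^ r) MeasureTheory.volume (-a) a := by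
  have h1 : IntervalIntegrable (fun θ : ℝ => |θ| ^ r) MeasureTheory.volume 0 a :=
    (intervalIntegral.intervalIntegrable_rpow' hr).congr fun θ hθ => by
      rw [uIoc_of_le ha] at hθ
      simp only [abs_of_pos hθ.1]
  have h2 : IntervalIntegrable (fun θ : ℝ => |θ| ^ r) MeasureTheory.volume 0 (-a) := by
    have h := (IntervalIntegrable.iff_comp_neg (f := fun θ : ℝ => |θ| ^ r)).1 h1
    simpa using h
  exact h2.symm.trans h1

theorem intervalIntegrable_diniQuot (hα : 0 < α) (f : HolderSpace α ℝ) (w : Circle) :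
    IntervalIntegrable (fun θ : ℝ => diniQuot f w (Circle.exp θ)) MeasureTheory.volume
      (-Real.pi) Real.pi := by
  have hexp : Continuous (Circle.exp : ℝ → Circle) := Circle.exp.continuous
  have hα' : (0 : ℝ) < α := by exact_mod_cast hα
  have h1 := (intervalIntegrable_abs_rpow (r := (α : ℝ) - 1) (by linarith)
    Real.pi_pos.le).const_mul (Real.pi / 2 * ‖f‖)
  refine h1.mono_fun' ?_ ?_
  · refine Measurable.aestronglyMeasurable (Measurable.div ?_ ?_)
    · exact (Complex.continuous_ofReal.comp
        ((f.continuous.comp (hexp.mul continuous_const)).sub continuous_const)).measurable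
    · exact ((continuous_circle_coe.comp hexp).sub continuous_const).measurable
  · rw [uIoc_of_le (by linarith [Real.pi_pos])]
    exact (MeasureTheory.ae_restrict_iff' measurableSet_Ioc).2
      (Eventually.of_forall fun θ hθ => norm_diniQuot_le f w hθ)

/-- The Dirichlet kernel as a telescoping sum. -/
theorem dirichlet_kernel_mul (z : ℂ) (hz : z ≠ 0) (N : ℕ) :
    (1 + ∑ n ∈ Finset.Icc 1 N, (z ^ n + z⁻¹ ^ n)) * (z - 1) = z ^ (N + 1) - z⁻¹ ^ N := by
  induction N with
  | zero => simp
  | succ N ih =>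
    rw [Finset.sum_Icc_succ_top (by omega), ← add_assoc, add_mul, ih]
    have h : z⁻¹ ^ N = z⁻¹ ^ (N + 1) * z := by
      rw [pow_succ, mul_assoc, inv_mul_cancel₀ hz, mul_one]
    rw [h]
    ring

/-- Dini's test at `w`: the integrals of `f(ζ w) - f(w)` against the Dirichlet kernels tend to
zero. -/
theorem tendsto_integral_dirichlet (hα : 0 < α) (f : HolderSpace α ℝ) (w : Circle) :
    Tendsto (fun N : ℕ => ∫ θ in (0 : ℝ)..(2 * Real.pi),
      (f (Circle.exp θ * w) - f w) * (1 + 2 * ∑ n ∈ Finset.Icc 1 N, ((Circle.exp θ : ℂ) ^ n).re))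
      atTop (𝓝 0) := by
  have hpi : -Real.pi ≤ Real.pi := by linarith [Real.pi_pos]
  have hRL := tendsto_intervalIntegral_exp_mul (fun θ => diniQuot f w (Circle.exp θ)) hpi
  have h1 := (hRL.mono_left atTop_le_cocompact).comp
    (tendsto_natCast_atTop_atTop.comp (tendsto_add_atTop_nat 1) :
      Tendsto (fun N : ℕ => (((N + 1 : ℕ) : ℝ))) atTop atTop)
  have h2 := (hRL.mono_left atBot_le_cocompact).comp
    (tendsto_neg_atTop_atBot.comp tendsto_natCast_atTop_atTop :
      Tendsto (fun N : ℕ => -((N : ℕ) : ℝ)) atTop atBot)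
  have h3 := h1.sub h2
  rw [sub_zero] at h3
  have h4 := (Complex.continuous_re.tendsto 0).comp h3
  refine h4.congr fun N => ?_
  have hint := intervalIntegrable_diniQuot hα f w
  have hi : ∀ x : ℝ, IntervalIntegrable (fun θ : ℝ => Complex.exp (x * θ * Complex.I) *
      diniQuot f w (Circle.exp θ)) MeasureTheory.volume (-Real.pi) Real.pi := fun x =>
    hint.continuousOn_mul (by fun_prop)
  simp only [Function.comp_apply]
  rw [← intervalIntegral.integral_sub (hi _) (hi _),
    integral_circle_eq_neg_pi_pi fun ζ : Circle =>
      (f (ζ * w) - f w) * (1 + 2 * ∑ n ∈ Finset.Icc 1 N, ((ζ : ℂ) ^ n).re)]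
  rw [← Complex.ofReal_re (∫ θ in (-Real.pi)..Real.pi, _), ← intervalIntegral.integral_ofReal]
  congr 1
  refine intervalIntegral.integral_congr fun θ _ => ?_
  set z := Circle.exp θ with hz
  have hz1 : Complex.exp (((N + 1 : ℕ) : ℝ) * θ * Complex.I) = (z : ℂ) ^ (N + 1) := by
    rw [hz, Circle.coe_exp, ← Complex.exp_nat_mul]
    congr 1
    push_cast
    ring
  have hz2 : Complex.exp ((-(N : ℝ) : ℝ) * θ * Complex.I) = (z : ℂ)⁻¹ ^ N := by
    rw [hz, Circle.coe_exp, ← Complex.exp_neg, ← Complex.exp_nat_mul]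
    congr 1
    push_cast
    ring
  have hre : ((1 + 2 * ∑ n ∈ Finset.Icc 1 N, ((z : ℂ) ^ n).re : ℝ) : ℂ) =
      1 + ∑ n ∈ Finset.Icc 1 N, ((z : ℂ) ^ n + (z : ℂ)⁻¹ ^ n) := by
    push_cast
    rw [Finset.mul_sum]
    congr 1
    refine Finset.sum_congr rfl fun n _ => ?_
    rw [← Circle.coe_inv, Circle.coe_inv_eq_conj, ← map_pow, Complex.add_conj]
    push_cast
    ring
  rw [hz1, hz2, ← sub_mul, ← dirichlet_kernel_mul _ (Circle.coe_ne_zero z), Complex.ofReal_mul,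
    hre, diniQuot]
  by_cases h : z = 1
  · simp [h]
  · have h' : (z : ℂ) - 1 ≠ 0 := sub_ne_zero.2 fun h' => h (Circle.ext h')
    field_simp

theorem integral_circle_pow_re {n : ℕ} (hn : 1 ≤ n) :
    ∫ θ in (0 : ℝ)..(2 * Real.pi), ((Circle.exp θ : ℂ) ^ n).re = 0 := by
  have hn0 : (n : ℝ) ≠ 0 := by positivity
  have h : ∀ θ : ℝ, ((Circle.exp θ : ℂ) ^ n).re = Real.cos (n * θ) := by
    intro θ
    rw [← Circle.coe_pow, ← Circle.exp_nsmul, Circle.coe_exp, Complex.exp_ofReal_mul_I_re,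
      nsmul_eq_mul]
  simp only [h]
  rw [intervalIntegral.integral_comp_mul_left _ hn0, integral_cos, mul_zero, Real.sin_zero,
    show (n : ℝ) * (2 * Real.pi) = (0 : ℝ) + n * (2 * Real.pi) by ring,
    Real.sin_add_nat_mul_two_pi]
  simp

/-- A Hölder function which is odd under complex conjugation is the sum of its sine series. -/
theorem mem_Y_of_odd (hα : 0 < α) (f : HolderSpace α ℝ) (hf : ∀ w : Circle, f w⁻¹ = -f w) :
    f ∈ Y α := by
  have hexp : Continuous (Circle.exp : ℝ → Circle) := Circle.exp.continuous
  refine ⟨fun n => Real.pi⁻¹ * ∫ θ in (0 : ℝ)..(2 * Real.pi),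
    f (Circle.exp θ) * ((Circle.exp θ : ℂ) ^ n).im, fun w => ?_⟩
  have hcz : Continuous fun θ : ℝ => (Circle.exp θ : ℂ) := continuous_circle_coe.comp hexp
  have hcf : Continuous fun θ : ℝ => f (Circle.exp θ) := f.continuous.comp hexp
  have hcfw : Continuous fun θ : ℝ => f (Circle.exp θ * w) :=
    f.continuous.comp (hexp.mul continuous_const)
  have hcre : ∀ n : ℕ, Continuous fun θ : ℝ => ((Circle.exp θ : ℂ) ^ n).re := fun n =>
    Complex.continuous_re.comp (hcz.pow n)
  -- The `n`-th term of the series is a convolution with `cos (n θ)`, since `f` is odd.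
  have hterm : ∀ n : ℕ, (∫ θ in (0 : ℝ)..(2 * Real.pi),
      f (Circle.exp θ) * ((Circle.exp θ : ℂ) ^ n).im) * ((w : ℂ) ^ n).im =
      ∫ θ in (0 : ℝ)..(2 * Real.pi), f (Circle.exp θ * w) * ((Circle.exp θ : ℂ) ^ n).re := by
    intro n
    have h1 := integral_circle_mul_right
      (fun ζ : Circle => f ζ * (((ζ * w⁻¹ : Circle) : ℂ) ^ n).re) w
    have h2 := integral_circle_inv (fun ζ : Circle => f ζ * (((ζ * w⁻¹ : Circle) : ℂ) ^ n).re)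
    have h3 : ∀ ζ : Circle, f ζ⁻¹ * (((ζ⁻¹ * w⁻¹ : Circle) : ℂ) ^ n).re =
        -(f ζ * (((ζ * w : Circle) : ℂ) ^ n).re) := by
      intro ζ
      rw [hf, ← mul_inv, Circle.coe_inv_eq_conj, ← map_pow, Complex.conj_re, neg_mul]
    simp only [h3, intervalIntegral.integral_neg] at h2
    simp only [mul_inv_cancel_right] at h1
    have h4 : ∀ ζ : Circle, f ζ * ((ζ : ℂ) ^ n).im * ((w : ℂ) ^ n).im =
        2⁻¹ * (f ζ * (((ζ * w⁻¹ : Circle) : ℂ) ^ n).re - f ζ * (((ζ * w : Circle) : ℂ) ^ n).re) := by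
      intro ζ
      rw [Circle.coe_mul, Circle.coe_mul, mul_pow, mul_pow, Circle.coe_inv_eq_conj, ← map_pow,
        Complex.mul_re, Complex.mul_re, Complex.conj_re, Complex.conj_im]
      ring
    have hc : ∀ v : Circle, IntervalIntegrable
        (fun θ : ℝ => f (Circle.exp θ) * (((Circle.exp θ * v : Circle) : ℂ) ^ n).re)
        MeasureTheory.volume 0 (2 * Real.pi) := fun v =>
      (hcf.mul (Complex.continuous_re.comp ((continuous_circle_coe.comp
        (hexp.mul continuous_const)).pow n))).intervalIntegrable _ _
    rw [← intervalIntegral.integral_mul_const]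
    simp only [h4]
    rw [intervalIntegral.integral_const_mul, intervalIntegral.integral_sub (hc _) (hc _), h1, ← h2]
    rw [← h2] at h1
    linarith
  have hmean : ∫ θ in (0 : ℝ)..(2 * Real.pi), f (Circle.exp θ * w) = 0 := by
    rw [integral_circle_mul_right (fun ζ => f ζ)]
    have h := integral_circle_inv (fun ζ : Circle => f ζ)
    simp only [hf, intervalIntegral.integral_neg] at h
    linarith
  have hlim := ((tendsto_integral_dirichlet hα f w).const_mul (2 * Real.pi)⁻¹).add_const (f w)
  rw [mul_zero, zero_add] at hlim
  refine hlim.congr fun N => ?_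
  have hsum : Continuous fun θ : ℝ => 2 * ∑ n ∈ Finset.Icc 1 N, ((Circle.exp θ : ℂ) ^ n).re :=
    continuous_const.mul (continuous_finsetSum _ fun n _ => hcre n)
  have hfterm : ∀ n : ℕ, Continuous fun θ : ℝ =>
      f (Circle.exp θ * w) * ((Circle.exp θ : ℂ) ^ n).re := fun n => hcfw.mul (hcre n)
  have hfsum : Continuous fun θ : ℝ =>
      2 * ∑ n ∈ Finset.Icc 1 N, f (Circle.exp θ * w) * ((Circle.exp θ : ℂ) ^ n).re :=
    continuous_const.mul (continuous_finsetSum _ fun n _ => hfterm n)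
  have hi1 : IntervalIntegrable (fun θ : ℝ => f (Circle.exp θ * w) *
      (1 + 2 * ∑ n ∈ Finset.Icc 1 N, ((Circle.exp θ : ℂ) ^ n).re)) MeasureTheory.volume 0
      (2 * Real.pi) := (hcfw.mul (continuous_const.add hsum)).intervalIntegrable _ _
  have hi2 : IntervalIntegrable (fun θ : ℝ => f w *
      (1 + 2 * ∑ n ∈ Finset.Icc 1 N, ((Circle.exp θ : ℂ) ^ n).re)) MeasureTheory.volume 0
      (2 * Real.pi) := (continuous_const.mul (continuous_const.add hsum)).intervalIntegrable _ _
  have hone : ∫ θ in (0 : ℝ)..(2 * Real.pi),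
      (1 + 2 * ∑ n ∈ Finset.Icc 1 N, ((Circle.exp θ : ℂ) ^ n).re) = 2 * Real.pi := by
    rw [intervalIntegral.integral_add intervalIntegrable_const
        (hsum.intervalIntegrable _ _),
      intervalIntegral.integral_const_mul, intervalIntegral.integral_finsetSum
        (fun n _ => (hcre n).intervalIntegrable _ _),
      Finset.sum_eq_zero fun n hn => integral_circle_pow_re (Finset.mem_Icc.1 hn).1]
    simp
  have hconv : ∫ θ in (0 : ℝ)..(2 * Real.pi), f (Circle.exp θ * w) *
      (1 + 2 * ∑ n ∈ Finset.Icc 1 N, ((Circle.exp θ : ℂ) ^ n).re) =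
      2 * ∑ n ∈ Finset.Icc 1 N, ∫ θ in (0 : ℝ)..(2 * Real.pi),
        f (Circle.exp θ * w) * ((Circle.exp θ : ℂ) ^ n).re := by
    have h : ∀ θ : ℝ, f (Circle.exp θ * w) *
        (1 + 2 * ∑ n ∈ Finset.Icc 1 N, ((Circle.exp θ : ℂ) ^ n).re) =
        f (Circle.exp θ * w) + 2 * ∑ n ∈ Finset.Icc 1 N,
          f (Circle.exp θ * w) * ((Circle.exp θ : ℂ) ^ n).re := by
      intro θ
      rw [← Finset.mul_sum]
      ring
    simp only [h]
    rw [intervalIntegral.integral_add (hcfw.intervalIntegrable _ _)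
        (hfsum.intervalIntegrable _ _), hmean, zero_add,
      intervalIntegral.integral_const_mul, intervalIntegral.integral_finsetSum
        (fun n _ => (hfterm n).intervalIntegrable _ _)]
  simp only [sub_mul]
  rw [intervalIntegral.integral_sub hi1 hi2, intervalIntegral.integral_const_mul,
    hone, hconv]
  simp only [mul_assoc Real.pi⁻¹, hterm]
  rw [← Finset.mul_sum]
  have hpi := Real.pi_ne_zero
  field_simp
  ring

/-- The odd part of the imaginary part, as a bounded projection onto `Y`. -/
def oddImCLM (hα : 0 < α) : HolderSpace α ℂ →L[ℝ] Y α :=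
  (HolderSpace.mkCLM hα (fun f w => ((f w).im - (f w⁻¹).im) / 2) 1 zero_le_one
    (fun f g w => by simp only [HolderSpace.add_apply, Complex.add_im]; ring)
    (fun c f w => by
      simp only [HolderSpace.smul_apply, Complex.smul_im, smul_eq_mul]
      ring)
    (fun f w => by
      have h1 := (Complex.abs_im_le_norm _).trans (f.norm_apply_le w)
      have h2 := (Complex.abs_im_le_norm _).trans (f.norm_apply_le w⁻¹)
      rw [Real.norm_eq_abs, abs_div, abs_two, one_mul]
      linarith [abs_sub (f w).im (f w⁻¹).im])
    (fun f w ξ => by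
      have h1 := (Complex.abs_im_le_norm _).trans (f.norm_sub_le w ξ)
      have h2 := (Complex.abs_im_le_norm _).trans (f.norm_sub_le w⁻¹ ξ⁻¹)
      rw [dist_circle_inv_inv] at h2
      have h3 : ((f w).im - (f w⁻¹).im) / 2 - ((f ξ).im - (f ξ⁻¹).im) / 2 =
          ((f w - f ξ).im - (f w⁻¹ - f ξ⁻¹).im) / 2 := by
        rw [Complex.sub_im, Complex.sub_im]; ring
      rw [h3, Real.norm_eq_abs, abs_div, abs_two, one_mul]
      linarith [abs_sub (f w - f ξ).im (f w⁻¹ - f ξ⁻¹).im]) :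
    HolderSpace α ℂ →L[ℝ] HolderSpace α ℝ).codRestrict (Y α) fun f =>
      mem_Y_of_odd hα _ fun w => by
        rw [HolderSpace.mkCLM_apply, HolderSpace.mkCLM_apply, inv_inv]
        ring

theorem oddImCLM_apply (hα : 0 < α) (f : HolderSpace α ℂ) (w : Circle) :
    (oddImCLM hα f).1 w = ((f w).im - (f w⁻¹).im) / 2 := rfl

end Dini

/-! ### Symmetry of the functional -/

section Symmetry

theorem circleDeriv_inv {Φ : Circle → ℂ} (hd : CircleDifferentiable Φ)
    (hΦ : ∀ w : Circle, Φ w⁻¹ = starRingEnd ℂ (Φ w)) (w : Circle) :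
    circleDeriv Φ w⁻¹ = starRingEnd ℂ (circleDeriv Φ w) := by
  refine circleDeriv_eq_of_hasDerivAt ?_
  have h0 : HasDerivAt (fun s : ℝ => Φ (Circle.exp s * w))
      (Complex.I * w * circleDeriv Φ w) (-0) := by
    simpa using hd.hasDerivAt w 0
  have h1 := (h0.scomp (0 : ℝ) (hasDerivAt_neg (0 : ℝ))).star
  refine (h1.congr_deriv ?_).congr_of_eventuallyEq (Eventually.of_forall fun t => ?_)
  · simp [← Circle.coe_inv_eq_conj]
  · change Φ (Circle.exp t * w⁻¹) = starRingEnd ℂ (Φ (Circle.exp (-t) * w))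
    rw [← hΦ, mul_inv, Circle.exp_neg, inv_inv]

theorem cauchyIntegrand_inv {Φ : Circle → ℂ} (hd : CircleDifferentiable Φ)
    (hΦ : ∀ w : Circle, Φ w⁻¹ = starRingEnd ℂ (Φ w)) (w ξ : Circle) :
    cauchyIntegrand Φ w⁻¹ ξ⁻¹ = starRingEnd ℂ (cauchyIntegrand Φ w ξ) := by
  simp only [cauchyIntegrand, hΦ, circleDeriv_inv hd hΦ, map_mul, map_div₀, map_sub]

theorem circleMean_inv {K L : Circle → ℂ} (h : ∀ ξ : Circle, L ξ⁻¹ = starRingEnd ℂ (K ξ)) :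
    circleMean L = starRingEnd ℂ (circleMean K) := by
  have h1 := integral_circle_inv fun ξ : Circle => L ξ * (ξ : ℂ)
  have h2 : ∀ f : Circle → ℂ, circleMean f =
      ((2 * Real.pi)⁻¹ : ℝ) * ∫ θ in (0 : ℝ)..(2 * Real.pi), f (Circle.exp θ) * Circle.exp θ := by
    intro f
    have h3 : ∀ ξ : Circle, f ξ * (Complex.I * (ξ : ℂ)) = Complex.I * (f ξ * ξ) := fun ξ => by ring
    simp only [circleMean, h3]
    rw [intervalIntegral.integral_const_mul, mul_inv, mul_assoc,
      inv_mul_cancel_left₀ Complex.I_ne_zero]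
    push_cast
    rfl
  rw [h2, h2, ← h1, map_mul, Complex.conj_ofReal, ← intervalIntegral.intervalIntegral_conj]
  simp only [h, Circle.coe_inv_eq_conj, map_mul]

theorem G_inv {Φ : Circle → ℂ} (hd : CircleDifferentiable Φ)
    (hΦ : ∀ w : Circle, Φ w⁻¹ = starRingEnd ℂ (Φ w)) (Ω : ℝ) (w : Circle) :
    G Ω Φ w⁻¹ = starRingEnd ℂ (G Ω Φ w) := by
  simp only [G, circleMean_inv (cauchyIntegrand_inv hd hΦ w), hΦ, circleDeriv_inv hd hΦ,
    Circle.coe_inv_eq_conj, map_mul, map_add, Complex.conj_ofReal, map_ofNat]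

variable {α : ℝ≥0}

theorem X_apply_inv (f : X α) (w : Circle) : f.1 w⁻¹ = starRingEnd ℂ (f.1 w) := by
  obtain ⟨a, ha⟩ := f.2
  refine tendsto_nhds_unique (ha w⁻¹)
    (((Complex.continuous_conj.tendsto _).comp (ha w)).congr fun N => ?_)
  simp only [Function.comp_apply, map_sum, map_mul, map_pow, Complex.conj_ofReal,
    Circle.coe_inv_eq_conj]

theorem Phi_inv (Q : ℝ) (f : X α) (w : Circle) :
    Phi Q f.1 w⁻¹ = starRingEnd ℂ (Phi Q f.1 w) := by
  simp only [Phi, X_apply_inv, map_add, map_div₀, Complex.conj_ofReal, Circle.coe_inv_eq_conj]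

end Symmetry

/-! ### Mixed partial derivatives -/

section Mixed

variable {E F : Type*} [NormedAddCommGroup E] [NormedSpace ℝ E] [NormedAddCommGroup F]
  [NormedSpace ℝ F] {f : ℝ × E → F} {s : Set (ℝ × E)}

theorem fderiv_partial_eq {p : ℝ × E} (hf : DifferentiableAt ℝ f p) :
    fderiv ℝ (fun y => f (p.1, y)) p.2 =
      (fderiv ℝ f p).comp (ContinuousLinearMap.inr ℝ ℝ E) :=
  (hf.hasFDerivAt.comp p.2 (hasFDerivAt_prodMk_right p.1 p.2)).fderiv

/-- A `C²` function has a continuous mixed derivative, in the operator norm. -/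
theorem mixed_partial_of_contDiffOn (hs : IsOpen s) (hf : ContDiffOn ℝ 2 f s) :
    (∀ p ∈ s, DifferentiableAt ℝ (fun q : ℝ => fderiv ℝ (fun y => f (q, y)) p.2) p.1) ∧
      ContinuousOn (fun p : ℝ × E => deriv (fun q : ℝ => fderiv ℝ (fun y => f (q, y)) p.2) p.1)
        s := by
  have hA : ContDiffOn ℝ 1
      (fun p => (fderiv ℝ f p).comp (ContinuousLinearMap.inr ℝ ℝ E)) s :=
    (hf.fderiv_of_isOpen hs (by norm_num)).clm_comp contDiffOn_const
  have hder : ∀ p ∈ s, HasDerivAt (fun q : ℝ => fderiv ℝ (fun y => f (q, y)) p.2)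
      (fderiv ℝ (fun p => (fderiv ℝ f p).comp (ContinuousLinearMap.inr ℝ ℝ E)) p (1, 0)) p.1 := by
    intro p hp
    have h1 := ((hA.differentiableOn one_ne_zero).differentiableAt (hs.mem_nhds hp)).hasFDerivAt
    have h2 : HasDerivAt (fun q : ℝ => (q, p.2)) ((1 : ℝ), (0 : E)) p.1 :=
      (hasDerivAt_id p.1).prodMk (hasDerivAt_const p.1 p.2)
    refine (h1.comp_hasDerivAt p.1 h2).congr_of_eventuallyEq ?_
    have h3 : ∀ᶠ q in 𝓝 p.1, (q, p.2) ∈ s :=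
      h2.continuousAt.eventually_mem (hs.mem_nhds hp)
    filter_upwards [h3] with q hq
    exact fderiv_partial_eq ((hf.differentiableOn two_ne_zero).differentiableAt (hs.mem_nhds hq))
  refine ⟨fun p hp => (hder p hp).differentiableAt, ?_⟩
  exact ((hA.continuousOn_fderiv_of_isOpen hs le_rfl).clm_apply continuousOn_const).congr
    fun p hp => (hder p hp).deriv

end Mixed

end VState

end


theorem proposition1 (α : ℝ≥0) (hα0 : 0 < α) (hα1 : α < 1) (ε : ℝ) (hε0 : 0 < ε) (hε1 : ε < 1) :
    -- the integral that defines the functional makes sense on the whole domain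
    (∀ p ∈ VState.domain α ε, ∀ w : Circle,
      (∀ ξ : Circle, ξ ≠ w → VState.Phi p.1 p.2.1 ξ ≠ VState.Phi p.1 p.2.1 w) ∧
      IntervalIntegrable
        (fun θ : ℝ => VState.cauchyIntegrand (VState.Phi p.1 p.2.1) w (Circle.exp θ) *
          (Complex.I * (Circle.exp θ : ℂ)))
        MeasureTheory.volume 0 (2 * Real.pi)) ∧
    -- the functional takes its values in `Y`
    ∃ 𝓕 : ℝ × VState.X α → VState.Y α,
      (∀ p ∈ VState.domain α ε, ∀ w : Circle, (𝓕 p).1 w = VState.F p.1 p.2.1 w) ∧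
      -- and is of class `C¹`
      ContDiffOn ℝ 1 𝓕 (VState.domain α ε) ∧
      -- `∂_Q ∂_f F` exists, as an operator in `L(X, Y)`, and is continuous
      (∀ p ∈ VState.domain α ε,
        DifferentiableAt ℝ (fun Q : ℝ => fderiv ℝ (fun f : VState.X α => 𝓕 (Q, f)) p.2) p.1) ∧
      ContinuousOn
        (fun p : ℝ × VState.X α =>
          deriv (fun Q : ℝ => fderiv ℝ (fun f : VState.X α => 𝓕 (Q, f)) p.2) p.1)
        (VState.domain α ε) := by
  have hopen : IsOpen (VState.domain α ε) := isOpen_Ioo.prod Metric.isOpen_ball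
  let 𝓕 : ℝ × VState.X α → VState.Y α := fun p =>
    VState.oddImCLM hα0 (VState.smoothG hα0 hα1 ((1 - p.1 ^ 2) / 4) (VState.phiC1 hα0 hα1 p))
  have hsmooth : ContDiffOn ℝ 2 𝓕 (VState.domain α ε) := by
    intro p hp
    have hΩ : ContDiff ℝ 2 fun p : ℝ × VState.X α => (1 - p.1 ^ 2) / 4 :=
      (contDiff_const.sub (contDiff_fst.pow 2)).div_const 4
    have h1 := (VState.contDiffAt_smoothG hα0 hα1 (n := 2)
      (p := ((1 - p.1 ^ 2) / 4, VState.phiC1 hα0 hα1 p))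
      (VState.isUnit_diffQuotCLM_phiC1 hα0 hα1 hε1 hp)).comp p
        (hΩ.prodMk (VState.contDiff_phiC1 hα0 hα1)).contDiffAt
    exact ((VState.oddImCLM hα0).contDiff.contDiffAt.comp p h1).contDiffWithinAt
  refine ⟨fun p hp w => ⟨fun ξ hξ => VState.phi_ne_phi hα0 hα1 hε1 hp hξ, ?_⟩, 𝓕, ?_,
    hsmooth.of_le one_le_two, VState.mixed_partial_of_contDiffOn hopen hsmooth⟩
  · rw [← VState.coe_phiC1 hα0 hα1]
    exact VState.intervalIntegrable_cauchyIntegrand _ w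
  · intro p hp w
    have hu := VState.isUnit_diffQuotCLM_phiC1 hα0 hα1 hε1 hp
    have hd := (VState.phiC1 hα0 hα1 p).circleDifferentiable_coe
    rw [VState.coe_phiC1] at hd
    rw [VState.oddImCLM_apply, VState.smoothG_apply hα0 hα1 _ hu,
      VState.smoothG_apply hα0 hα1 _ hu, VState.coe_phiC1,
      VState.G_inv hd (VState.Phi_inv p.1 p.2), Complex.conj_im, VState.F]
    ring
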